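/- A \emph{$d$-polytope} $P\subset\mathbb{R}^n$ is the union of a finite complex of cells: each cell is the convex hull of a finite nonempty set of points (its vertices) and has dimension at most $d$, at least one cell has dimension $d$, every face of a cell is a cell, and any two cells meet in a (possibly empty) common face, spanned by their common vertices. The vertices of $P$ are the vertices of its cells, and $\partial P$ is the set of points that lie in the relative boundary of exactly one $d$-cell. A \emph{triangulation} $T$ of $P$ is a finite geometric simplicial complex with union $P$. A labelling (colouring) $\ell$ of the vertices of $P$ and of $T$ is a \emph{generalized Sperner labelling} if, whenever a vertex $v$ of $T$ lies in a cell $C$, $\ell(v)$ is the label of some vertex of $P$ in the affine span $\operatorname{aff}(C)$. \textbf{Theorem.} Let $P$ be a $d$-polytope, $T$ a triangulation of $P$, and $\ell$ a generalized Sperner labelling such that the vertices of $P$ on $\partial P$ have pairwise different colours. For every colour $c$ occurring on $T$ let $p_c$ be a vertex of $P$ of colour $c$ such that $p_{\ell(v)}\in\operatorname{aff}(C)$ whenever a vertex $v$ of $T$ lies in a cell $C$. (If the vertices of $P$ have pairwise different colours, for instance if $P$ is a convex polytope with its faces as cells and its vertices are coloured differently, then $p_c$ is just the vertex of colour $c$,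 and the condition is the generalized Sperner condition.) Let $H_t$, $t\in[0,1]$, be the homotopy that moves each vertex $v$ of $T$ along $(1-t)v+t\,p_{\ell(v)}$ and is extended to each simplex of $T$ by barycentric coordinates. Let $S$ be a set of simplices of $T$ with $$\partial P\not\subset\bigcup_{s\in S}\partial H_1(s),$$ where $\partial H_1(s)$ is the relative boundary of the convex set $H_1(s)$. Then $T$ has a full-coloured simplex $\tau$ (a $d$-simplex whose $d+1$ vertices have pairwise different colours) such that, for every $s\in S$, the set of colours of the vertices of $\tau$ differs from the set of colours of the vertices of $s$. -/

import Mathlib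

/-- The point set `F` spans a (possibly empty) face of the convex hull of the point set `C`, and
consists of all the points of `C` that lie on that face. -/
structure IsHullFace {n : ℕ} (F C : Set (EuclideanSpace ℝ (Fin n))) : Prop where
  subset : F ⊆ C
  isExtreme : IsExtreme ℝ (convexHull ℝ C) (convexHull ℝ F)
  mem_of_mem_hull : ∀ v ∈ C, v ∈ convexHull ℝ F → v ∈ F

/-- A `d`-polytope in `ℝⁿ`: a finite complex of cells. A cell is the convex hull of a finite
nonempty set of points and is recorded by that set. The cells have dimension at most `d`, at least
one has dimension `d`, faces of cells are cells, and two cells meet in a common face (which may be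
empty) spanned by their common vertices. -/
structure Polytope (n d : ℕ) where
  cells : Set (Finset (EuclideanSpace ℝ (Fin n)))
  finite_cells : cells.Finite
  nonempty_of_mem : ∀ C ∈ cells, C.Nonempty
  dim_le : ∀ C ∈ cells,
    Module.finrank ℝ (vectorSpan ℝ (C : Set (EuclideanSpace ℝ (Fin n)))) ≤ d
  exists_dim_eq : ∃ C ∈ cells,
    Module.finrank ℝ (vectorSpan ℝ (C : Set (EuclideanSpace ℝ (Fin n)))) = d
  face_mem : ∀ C ∈ cells, ∀ F : Finset (EuclideanSpace ℝ (Fin n)), F.Nonempty →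
    IsHullFace (F : Set (EuclideanSpace ℝ (Fin n))) C → F ∈ cells
  inter_eq : ∀ C ∈ cells, ∀ D ∈ cells,
    convexHull ℝ (C : Set (EuclideanSpace ℝ (Fin n))) ∩ convexHull ℝ D =
      convexHull ℝ ((C : Set (EuclideanSpace ℝ (Fin n))) ∩ D)
  inter_face : ∀ C ∈ cells, ∀ D ∈ cells,
    IsHullFace ((C : Set (EuclideanSpace ℝ (Fin n))) ∩ D) C

namespace Polytope

variable {n d : ℕ} (P : Polytope n d)

/-- The underlying point set: the union of all cells. -/
def space : Set (EuclideanSpace ℝ (Fin n)) :=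
  ⋃ C ∈ P.cells, convexHull ℝ (C : Set (EuclideanSpace ℝ (Fin n)))

/-- The vertices of the polytope: all vertices of its cells. -/
def vertices : Set (EuclideanSpace ℝ (Fin n)) :=
  {v | ∃ C ∈ P.cells, v ∈ C}

/-- The boundary `∂P`: the points that lie in the relative boundary of exactly one `d`-cell. -/
def boundary : Set (EuclideanSpace ℝ (Fin n)) :=
  {x | ∃! C : Finset (EuclideanSpace ℝ (Fin n)), C ∈ P.cells ∧
    Module.finrank ℝ (vectorSpan ℝ (C : Set (EuclideanSpace ℝ (Fin n)))) = d ∧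
    x ∈ intrinsicFrontier ℝ (convexHull ℝ (C : Set (EuclideanSpace ℝ (Fin n))))}

end Polytope

/-- `T` is a (finite) triangulation of the polytope `P`. -/
structure IsTriangulation {n d : ℕ} (P : Polytope n d)
    (T : Geometry.SimplicialComplex ℝ (EuclideanSpace ℝ (Fin n))) : Prop where
  finite : T.faces.Finite
  space_eq : T.space = P.space

/-- Generalized Sperner labelling: whenever a `T`-vertex `v` lies in a cell `C` of `P`, its label is
the label of some vertex of `P` in the affine span of `C`. -/
def IsGeneralizedSperner {n d : ℕ} {κ : Type*} (P : Polytope n d)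
    (T : Geometry.SimplicialComplex ℝ (EuclideanSpace ℝ (Fin n)))
    (label : EuclideanSpace ℝ (Fin n) → κ) : Prop :=
  ∀ v ∈ T.vertices, ∀ C ∈ P.cells,
    v ∈ convexHull ℝ (C : Set (EuclideanSpace ℝ (Fin n))) →
      ∃ w ∈ P.vertices, w ∈ affineSpan ℝ (C : Set (EuclideanSpace ℝ (Fin n))) ∧ label w = label v

/-- `dest` chooses, for each colour used on `T`, the vertex of `P` of that colour to which the
`T`-vertices of that colour travel; a `T`-vertex in a cell stays in the affine span of the cell.
If the vertices of `P` have pairwise distinct colours, such a `dest` exists exactly for the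
generalized Sperner labellings, and is unique on the colours used. -/
def IsDestination {n d : ℕ} {κ : Type*} (P : Polytope n d)
    (T : Geometry.SimplicialComplex ℝ (EuclideanSpace ℝ (Fin n)))
    (label : EuclideanSpace ℝ (Fin n) → κ) (dest : κ → EuclideanSpace ℝ (Fin n)) : Prop :=
  ∀ v ∈ T.vertices, dest (label v) ∈ P.vertices ∧ label (dest (label v)) = label v ∧
    ∀ C ∈ P.cells, v ∈ convexHull ℝ (C : Set (EuclideanSpace ℝ (Fin n))) →
      dest (label v) ∈ affineSpan ℝ (C : Set (EuclideanSpace ℝ (Fin n)))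

/-- `w` is the system of barycentric coordinates of `x` with respect to `T`: a convex combination
of the vertices of one simplex of `T` that represents `x`. -/
structure IsBarycentric {n : ℕ} (T : Geometry.SimplicialComplex ℝ (EuclideanSpace ℝ (Fin n)))
    (x : EuclideanSpace ℝ (Fin n)) (w : EuclideanSpace ℝ (Fin n) →₀ ℝ) : Prop where
  support_mem : w.support ∈ T.faces
  nonneg : ∀ v, 0 ≤ w v
  sum_eq_one : (w.sum fun _ a => a) = 1
  sum_smul_eq : (w.sum fun v a => a • v) = x

open Classical in
/-- The barycentric coordinates of `x` with respect to `T` (zero outside the space of `T`). -/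
noncomputable def barycentric {n : ℕ}
    (T : Geometry.SimplicialComplex ℝ (EuclideanSpace ℝ (Fin n)))
    (x : EuclideanSpace ℝ (Fin n)) : EuclideanSpace ℝ (Fin n) →₀ ℝ :=
  if h : ∃ w, IsBarycentric T x w then h.choose else 0

/-- The homotopy `H_t` induced by the labelling: each `T`-vertex `v` moves linearly, in time
`t ∈ [0, 1]`, to `dest (label v)`, and this is extended to every simplex of `T` by barycentric
coordinates. -/
noncomputable def labelHomotopy {n : ℕ} {κ : Type*}
    (T : Geometry.SimplicialComplex ℝ (EuclideanSpace ℝ (Fin n)))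
    (label : EuclideanSpace ℝ (Fin n) → κ) (dest : κ → EuclideanSpace ℝ (Fin n))
    (t : ℝ) (x : EuclideanSpace ℝ (Fin n)) : EuclideanSpace ℝ (Fin n) :=
  (barycentric T x).sum fun v a => a • ((1 - t) • v + t • dest (label v))

/-- A full-coloured simplex of `T`: a `d`-simplex whose `d + 1` vertices have distinct colours. -/
def IsFullColoured {n : ℕ} {κ : Type*} (d : ℕ)
    (T : Geometry.SimplicialComplex ℝ (EuclideanSpace ℝ (Fin n)))
    (label : EuclideanSpace ℝ (Fin n) → κ) (s : Finset (EuclideanSpace ℝ (Fin n))) : Prop :=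
  s ∈ T.faces ∧ s.card = d + 1 ∧ Set.InjOn label (s : Set (EuclideanSpace ℝ (Fin n)))

/-! The proof is a mod 2 degree argument. Take a boundary point `x` on no `∂H₁(s)`, `s ∈ S`, let `C`
be the only `d`-cell with `x` in its relative boundary, and let `A` be the affine span of `C`. For a
point `y` of `A` in general position, count modulo 2 the simplices of `T` spanning `A` whose image
under `H₁` contains `y`.

This parity does not change if the vertices are left in place
(`IsDestination.sum_hullIndicator_eq`). Move the vertices one at a time. The old positions of the
vertices of a `d`-simplex and the new position of one of them are `d + 2` points of `A`, and a
generic point lies in an even number of the simplices spanned by `d + 1` of these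
(`even_card_mem_convexHull_erase`). So the change is a sum over the facets that contain the moving
vertex. Such a facet either belongs to an even number of spanning simplices
(`IsTriangulation.even_card_spanning_facet`), or all its vertices have destinations in its own
affine span, and then its contribution misses every generic point.

With the vertices in place the parity is 1 at generic points of `C` and 0 at generic points of `A`
outside `C` near `x`, because `C` is the only cell that spans `A` and contains `x`
(`Polytope.eq_of_mem_of_unique`). Hence the parity of the images jumps at `x`, and `x` lies in the
relative boundary of some image spanning `A`. The simplex behind this image is full-coloured. If its
colour set were that of some `s ∈ S`, the image would be `H₁(s)`, contrary to the choice of `x`. -/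

open Filter Topology AffineMap

/-! ### Short moves along a line, and generic points of convex sets. -/

section Generic

variable {E : Type*} [NormedAddCommGroup E] [NormedSpace ℝ E]

theorem AffineSubspace.mem_of_lineMap_mem {B : AffineSubspace ℝ E} {x b : E} {s : ℝ} (hs : s ≠ 0)
    (hx : x ∈ B) (h : lineMap x b s ∈ B) : b ∈ B := by
  have := AffineMap.lineMap_mem s⁻¹ hx h
  rwa [lineMap_lineMap_right, inv_mul_cancel₀ hs, lineMap_apply_one] at this

theorem tendsto_lineMap_zero (x b : E) :
    Tendsto (fun s : ℝ => lineMap x b s) (𝓝[>] 0) (𝓝 x) := by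
  have : Continuous fun s : ℝ => (lineMap x b s : E) := AffineMap.lineMap_continuous
  have h := (this.tendsto 0).mono_left (nhdsWithin_le_nhds (s := Set.Ioi 0))
  simpa using h

theorem eventually_lineMap_notMem_of_isClosed {S : Set E} (hS : IsClosed S) {x : E} (hx : x ∉ S)
    (b : E) : ∀ᶠ s in 𝓝[>] (0 : ℝ), lineMap x b s ∉ S :=
  (tendsto_lineMap_zero x b).eventually (hS.isOpen_compl.mem_nhds hx)

/-- Closed sets missing `x` miss a neighbourhood of it. This carries incidences with cells or
simplices from a perturbed point back to `x`. -/
theorem eventually_mem_of_lineMap_mem {ι : Type*} {I : Set ι} (hI : I.Finite) {S : ι → Set E}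
    (hS : ∀ i ∈ I, IsClosed (S i)) (x b : E) :
    ∀ᶠ s in 𝓝[>] (0 : ℝ), ∀ i ∈ I, lineMap x b s ∈ S i → x ∈ S i := by
  rw [eventually_all_finite hI]
  intro i hi
  by_cases hx : x ∈ S i
  · exact Eventually.of_forall fun _ _ => hx
  · filter_upwards [eventually_lineMap_notMem_of_isClosed (hS i hi) hx b] with s hs h
    exact absurd h hs

theorem eventually_mem_Ioo_zero_one : ∀ᶠ s in 𝓝[>] (0 : ℝ), s ∈ Set.Ioo (0 : ℝ) 1 :=
  Ioo_mem_nhdsGT one_pos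

variable [FiniteDimensional ℝ E]

/-- A line through `b ∉ B` meets `B` in at most one point, so `x` itself may lie in `B`. -/
theorem AffineSubspace.eventually_lineMap_notMem {B : AffineSubspace ℝ E} {b : E} (hb : b ∉ B)
    (x : E) : ∀ᶠ s in 𝓝[>] (0 : ℝ), lineMap x b s ∉ B := by
  by_cases hx : x ∈ B
  · filter_upwards [self_mem_nhdsWithin] with s hs h
    exact hb (B.mem_of_lineMap_mem (ne_of_gt hs) hx h)
  · exact eventually_lineMap_notMem_of_isClosed B.closed_of_finiteDimensional hx b

/-- A nonempty convex set contains a point outside any finite family of affine subspaces, none of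
which contains it. -/
theorem Convex.exists_generic {K : Set E} (hK : Convex ℝ K) (hne : K.Nonempty)
    {𝓑 : Set (AffineSubspace ℝ E)} (h𝓑 : 𝓑.Finite) :
    ∃ z ∈ K, ∀ B ∈ 𝓑, z ∈ B → K ⊆ B := by
  induction 𝓑, h𝓑 using Set.Finite.induction_on with
  | empty => exact ⟨_, hne.some_mem, by simp⟩
  | @insert B 𝓑 _ hfin ih =>
    obtain ⟨z, hz, hzB⟩ := ih
    by_cases hKB : K ⊆ B
    · exact ⟨z, hz, by rintro B' (rfl | hB') h; exacts [hKB, hzB _ hB' h]⟩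
    obtain ⟨w, hw, hwB⟩ := Set.not_subset.1 hKB
    -- A short move from `z` towards `w` leaves `B` and enters none of the earlier subspaces that
    -- avoid `z`.
    have h1 := AffineSubspace.eventually_lineMap_notMem hwB z
    have h2 := eventually_mem_of_lineMap_mem hfin (S := fun B : AffineSubspace ℝ E => (B : Set E))
      (fun B _ => B.closed_of_finiteDimensional) z w
    obtain ⟨s, hs1, hs2, hs3⟩ := (h1.and (h2.and eventually_mem_Ioo_zero_one)).exists
    refine ⟨lineMap z w s, hK.lineMap_mem hz hw ⟨hs3.1.le, hs3.2.le⟩, ?_⟩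
    rintro B' (rfl | hB') h
    · exact absurd h hs1
    · exact hzB _ hB' (hs2 _ hB' h)

omit [FiniteDimensional ℝ E] in
theorem Finset.isClosed_convexHull_coe (s : Finset E) : IsClosed (convexHull ℝ (s : Set E)) :=
  s.finite_toSet.isClosed_convexHull (𝕜 := ℝ)

end Generic

/-! ### Parity for `d + 2` points in dimension `d`. -/

section Parity

variable {ι E : Type*} [AddCommGroup E] [Module ℝ E]

/-- A point of the standard polytope `w ≥ 0` can be moved along a direction with a negative
coordinate until a new coordinate vanishes. -/
theorem exists_first_zero (I : Finset ι) (w k : ι → ℝ) (hw : ∀ i ∈ I, 0 ≤ w i)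
    (hk : ∃ i ∈ I, k i < 0) :
    ∃ s, ∃ j ∈ I, k j < 0 ∧ w j + s * k j = 0 ∧ ∀ i ∈ I, 0 ≤ w i + s * k i := by
  classical
  -- The ratio test of the simplex method: the smallest ratio is the time at which the first
  -- coordinate vanishes.
  obtain ⟨j, hj, hmin⟩ := (I.filter fun i => k i < 0).exists_min_image (fun i => w i / -k i)
    (by obtain ⟨i, hi, h⟩ := hk; exact ⟨i, by simp [hi, h]⟩)
  simp only [Finset.mem_filter, and_imp] at hj hmin
  have hs : 0 ≤ w j / -k j := div_nonneg (hw j hj.1) (by linarith)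
  refine ⟨w j / -k j, j, hj.1, hj.2, ?_, fun i hi => ?_⟩
  · have := hj.2.ne
    field_simp
    ring
  · rcases lt_or_ge (k i) 0 with h | h
    · have := hmin i hi h
      rw [le_div_iff₀ (by linarith)] at this
      linarith
    · have := hw i hi
      positivity

variable [DecidableEq ι]

/-- `y` is a convex combination of the points `q i`, `i ∈ I`, in which `q j` has weight `0`. -/
def IsConvexCombOmitting (I : Finset ι) (q : ι → E) (y : E) (j : ι) (w : ι → ℝ) : Prop :=
  (∀ i ∈ I, 0 ≤ w i) ∧ ∑ i ∈ I, w i = 1 ∧ ∑ i ∈ I, w i • q i = y ∧ w j = 0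

theorem mem_convexHull_image_iff_exists {I : Finset ι} {q : ι → E} {y : E} :
    y ∈ convexHull ℝ (q '' I) ↔
      ∃ w : ι → ℝ, (∀ i ∈ I, 0 ≤ w i) ∧ ∑ i ∈ I, w i = 1 ∧ ∑ i ∈ I, w i • q i = y := by
  constructor
  · intro h
    have := convexHull_min (s := q '' I) (t := {y | ∃ w : ι → ℝ, (∀ i ∈ I, 0 ≤ w i) ∧
      ∑ i ∈ I, w i = 1 ∧ ∑ i ∈ I, w i • q i = y}) ?_ ?_ h
    · exact this
    · rintro _ ⟨i, hi, rfl⟩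
      refine ⟨Pi.single i 1, fun j _ => ?_, ?_, ?_⟩
      · by_cases h : j = i
        · subst h; simp
        · simp [h]
      · simpa [Finset.sum_pi_single] using hi
      · rw [Finset.sum_eq_single_of_mem i hi]
        · simp
        · intro j _ hj; simp [hj]
    · rintro _ ⟨w, hw, hw1, rfl⟩ _ ⟨w', hw', hw1', rfl⟩ a b ha hb hab
      refine ⟨fun i => a * w i + b * w' i, fun i hi => ?_, ?_, ?_⟩
      · have := hw i hi; have := hw' i hi; positivity
      · rw [Finset.sum_add_distrib, ← Finset.mul_sum, ← Finset.mul_sum, hw1, hw1']; simpa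
      · simp only [add_smul, mul_smul, Finset.sum_add_distrib, Finset.smul_sum]
  · rintro ⟨w, hw, hw1, rfl⟩
    rw [← Finset.centerMass_eq_of_sum_1 _ _ hw1]
    exact Finset.centerMass_mem_convexHull _ hw (by rw [hw1]; exact one_pos)
      fun i hi => Set.mem_image_of_mem _ hi

theorem mem_convexHull_image_erase_iff {I : Finset ι} {q : ι → E} {y : E} {j : ι} (hj : j ∈ I) :
    y ∈ convexHull ℝ (q '' (I.erase j : Finset ι)) ↔ ∃ w, IsConvexCombOmitting I q y j w := by
  rw [mem_convexHull_image_iff_exists]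
  constructor
  · rintro ⟨w, hw, hw1, hwy⟩
    refine ⟨Function.update w j 0, fun i hi => ?_, ?_, ?_, by simp⟩
    · by_cases h : i = j
      · subst h; simp
      · simpa [h] using hw i (by simp [h, hi])
    · rw [← Finset.add_sum_erase _ _ hj, ← hw1]
      simp only [Function.update_self, zero_add]
      exact Finset.sum_congr rfl fun i hi => by rw [Function.update_of_ne (Finset.ne_of_mem_erase hi)]
    · rw [← Finset.add_sum_erase _ _ hj, ← hwy]
      simp only [Function.update_self, zero_smul, zero_add]
      exact Finset.sum_congr rfl fun i hi => by rw [Function.update_of_ne (Finset.ne_of_mem_erase hi)]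
  · rintro ⟨w, hw, hw1, hwy, hwj⟩
    refine ⟨w, fun i hi => hw i (Finset.mem_of_mem_erase hi), ?_, ?_⟩
    · rw [← hw1, ← Finset.add_sum_erase _ _ hj, hwj, zero_add]
    · rw [← hwy, ← Finset.add_sum_erase _ _ hj, hwj, zero_smul, zero_add]

omit [DecidableEq ι] in
/-- Moving a convex combination along an affine dependence. -/
theorem IsConvexCombOmitting.exists_move {I : Finset ι} {q : ι → E} {y : E} {i : ι} {w k : ι → ℝ}
    (hw : IsConvexCombOmitting I q y i w) (hk : ∑ j ∈ I, k j = 0)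
    (hkq : ∑ j ∈ I, k j • q j = 0) (hk0 : ∃ j ∈ I, k j ≠ 0) :
    ∃ s, ∃ j ∈ I, k j < 0 ∧ IsConvexCombOmitting I q y j fun i => w i + s * k i := by
  obtain ⟨j, hj, hneg⟩ : ∃ j ∈ I, k j < 0 := by
    by_contra! h
    obtain ⟨j, hj, hj0⟩ := hk0
    exact hj0 ((Finset.sum_eq_zero_iff_of_nonneg h).1 hk j hj)
  obtain ⟨s, j, hj, hkj, hz, hnn⟩ := exists_first_zero I w k hw.1 ⟨j, hj, hneg⟩
  refine ⟨s, j, hj, hkj, hnn, ?_, ?_, hz⟩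
  · rw [Finset.sum_add_distrib, ← Finset.mul_sum, hk, hw.2.1, mul_zero, add_zero]
  · simp only [add_smul, mul_smul, Finset.sum_add_distrib, ← Finset.smul_sum, hkq, hw.2.2.1,
      smul_zero, add_zero]

/-- A point in general position with respect to `d + 2` points of a `d`-dimensional space lies in
an even number of the simplices spanned by `d + 1` of them. -/
theorem even_card_mem_convexHull_erase {I : Finset ι} {q : ι → E} {y : E}
    (hdep : ∃ k : ι → ℝ, ∑ j ∈ I, k j = 0 ∧ ∑ j ∈ I, k j • q j = 0 ∧ ∃ j ∈ I, k j ≠ 0)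
    (hgen : ∀ i ∈ I, ∀ j ∈ I, i ≠ j → y ∉ convexHull ℝ (q '' ((I.erase i).erase j : Finset ι)))
    [DecidablePred fun j => y ∈ convexHull ℝ (q '' (I.erase j : Finset ι))] :
    Even (I.filter fun j => y ∈ convexHull ℝ (q '' (I.erase j : Finset ι))).card := by
  -- General position: no convex combination representing `y` has two zero weights.
  have huniq : ∀ i ∈ I, ∀ j ∈ I, ∀ w, IsConvexCombOmitting I q y i w → w j = 0 → i = j := by
    intro i hi j hj w hw hwj
    by_contra hij
    refine hgen i hi j hj hij ?_
    rw [mem_convexHull_image_erase_iff (by simp [hj, Ne.symm hij])]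
    refine ⟨w, fun l hl => hw.1 l (Finset.mem_of_mem_erase hl), ?_, ?_, hwj⟩
    · rw [← hw.2.1, ← Finset.add_sum_erase _ _ hi, hw.2.2.2, zero_add]
    · rw [← hw.2.2.1, ← Finset.add_sum_erase _ _ hi, hw.2.2.2, zero_smul, zero_add]
  -- Moving `w` along a nontrivial dependence with `k i = 0` would make a second weight vanish. So
  -- an affine dependence is determined by its value at `i`.
  have hker : ∀ i ∈ I, ∀ w k : ι → ℝ, IsConvexCombOmitting I q y i w → ∑ j ∈ I, k j = 0 →
      ∑ j ∈ I, k j • q j = 0 → k i = 0 → ∀ j ∈ I, k j = 0 := by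
    intro i hi w k hw hk hkq hki
    by_contra! h
    obtain ⟨s, j, hj, hkj, hw'⟩ := hw.exists_move hk hkq h
    have := huniq j hj i hi _ hw' (by rw [hw.2.2.2, hki]; ring)
    subst this
    exact hkj.ne hki
  rcases (I.filter fun j => y ∈ convexHull ℝ (q '' (I.erase j : Finset ι))).eq_empty_or_nonempty
    with h | ⟨i, hi⟩
  · rw [h]; simp
  rw [Finset.mem_filter] at hi
  obtain ⟨hi, hyi⟩ := hi
  obtain ⟨w, hw⟩ := (mem_convexHull_image_erase_iff hi).1 hyi
  -- One simplex containing `y` yields a second: with the sign chosen so that `k i > 0`, the weight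
  -- that vanishes along the move is not that of `i`.
  obtain ⟨j, hij, hj, w', hw'⟩ : ∃ j, i ≠ j ∧ j ∈ I ∧ ∃ w', IsConvexCombOmitting I q y j w' := by
    obtain ⟨k, hk, hkq, hk0⟩ := hdep
    have hki : k i ≠ 0 := fun h => by
      obtain ⟨j, hj, hj0⟩ := hk0
      exact hj0 (hker i hi w k hw hk hkq h j hj)
    wlog hpos : 0 < k i generalizing k
    · refine this (-k) (by simpa using hk) (by simpa using hkq) (by simpa using hk0)
        (by simpa using hki) ?_
      have := lt_of_le_of_ne (not_lt.1 hpos) hki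
      simpa using this
    obtain ⟨s, j, hj, hkj, hw'⟩ := hw.exists_move hk hkq hk0
    exact ⟨j, by rintro rfl; linarith, hj, _, hw'⟩
  have key : (I.filter fun j => y ∈ convexHull ℝ (q '' (I.erase j : Finset ι))) = {i, j} := by
    ext l
    simp only [Finset.mem_filter, Finset.mem_insert, Finset.mem_singleton]
    constructor
    swap
    · rintro (rfl | rfl)
      · exact ⟨hi, hyi⟩
      · exact ⟨hj, (mem_convexHull_image_erase_iff hj).2 ⟨w', hw'⟩⟩
    rintro ⟨hl, hyl⟩
    obtain ⟨u, hu⟩ := (mem_convexHull_image_erase_iff hl).1 hyl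
    by_contra! hne
    -- the two combinations `w'`, `u` differ from `w` by proportional vectors
    have hprop : ∀ m ∈ I, u i * (w' m - w m) = w' i * (u m - w m) := by
      intro m hm
      have := hker i hi w (fun m => u i * (w' m - w m) - w' i * (u m - w m)) hw ?_ ?_ ?_ m hm
      · exact sub_eq_zero.1 this
      · rw [Finset.sum_sub_distrib, ← Finset.mul_sum, ← Finset.mul_sum, Finset.sum_sub_distrib,
          Finset.sum_sub_distrib, hw.2.1, hw'.2.1, hu.2.1]
        ring
      · simp only [sub_smul, mul_smul, Finset.sum_sub_distrib, ← Finset.smul_sum, hw.2.2.1,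
          hw'.2.2.1, hu.2.2.1]
        simp
      · simp only [hw.2.2.2]
        ring
    have hui : 0 < u i := lt_of_le_of_ne (hu.1 i hi) fun h => hne.1 (huniq l hl i hi u hu h.symm)
    have hwi' : 0 < w' i :=
      lt_of_le_of_ne (hw'.1 i hi) fun h => hij (huniq j hj i hi w' hw' h.symm).symm
    have hwj : 0 < w j := lt_of_le_of_ne (hw.1 j hj) fun h => hij (huniq i hi j hj w hw h.symm)
    have hwl : 0 < w l := lt_of_le_of_ne (hw.1 l hl) fun h => hne.1 (huniq i hi l hl w hw h.symm).symm
    have h1 := hprop j hj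
    have h2 := hprop l hl
    have h3 := hw'.1 l hl
    have h4 := hu.1 j hj
    have h5 : 0 < w' l := lt_of_le_of_ne h3 fun h => hne.2 (huniq j hj l hl w' hw' h.symm).symm
    have h6 : 0 < u j := lt_of_le_of_ne h4 fun h => hne.2 (huniq l hl j hj u hu h.symm)
    rw [hw'.2.2.2] at h1
    rw [hu.2.2.2] at h2
    -- The proportionality at `j`, where `w'` vanishes, and at `l`, where `u` vanishes, gives `u i -
    -- w' i` opposite signs.
    have : (u i - w' i) * w j < 0 := by nlinarith
    have : 0 < (u i - w' i) * w l := by nlinarith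
    have : u i - w' i < 0 := by
      by_contra! h
      nlinarith
    nlinarith
  rw [key, Finset.card_pair hij]
  exact even_two

end Parity

/-! ### Weights of affine and convex combinations; faces. -/

section Weights

variable {E : Type*} [AddCommGroup E] [Module ℝ E]

theorem Finset.exists_weights_of_mem_affineSpan {s : Finset E} {a : E}
    (ha : a ∈ affineSpan ℝ (s : Set E)) :
    ∃ c : E → ℝ, ∑ v ∈ s, c v = 1 ∧ ∑ v ∈ s, c v • v = a := by
  have h : a ∈ affineSpan ℝ (Set.range ((↑) : s → E)) := by simpa using ha
  obtain ⟨w, hw, rfl⟩ := eq_affineCombination_of_mem_affineSpan_of_fintype h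
  classical
  refine ⟨fun v => if h : v ∈ s then w ⟨v, h⟩ else 0, ?_, ?_⟩
  · rw [← Finset.sum_coe_sort s]
    simpa using hw
  · rw [Finset.affineCombination_eq_linear_combination _ _ _ hw, ← Finset.sum_coe_sort s]
    simp

theorem Finset.sum_smul_mem_affineSpan {s : Finset E} {c : E → ℝ} (hc : ∑ v ∈ s, c v = 1) :
    ∑ v ∈ s, c v • v ∈ affineSpan ℝ (s : Set E) := by
  have := affineCombination_mem_affineSpan (k := ℝ) (s := (Finset.univ : Finset s))
    (w := fun v => c v) (by rw [Finset.sum_coe_sort s]; exact hc) ((↑) : s → E)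
  rw [Finset.affineCombination_eq_linear_combination _ _ _
    (by rw [Finset.sum_coe_sort s]; exact hc)] at this
  rw [← Finset.sum_coe_sort s]
  simpa using this

theorem Finset.eq_of_sum_smul_eq {s : Finset E} (hs : AffineIndependent ℝ ((↑) : s → E))
    {c c' : E → ℝ} (h1 : ∑ v ∈ s, c v = ∑ v ∈ s, c' v)
    (h2 : ∑ v ∈ s, c v • v = ∑ v ∈ s, c' v • v) : ∀ v ∈ s, c v = c' v := by
  intro v hv
  have := affineIndependent_iff.1 hs Finset.univ (fun v => c v - c' v)
    (by rw [Finset.sum_coe_sort s (fun v => c v - c' v), Finset.sum_sub_distrib, h1, sub_self])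
    (by rw [Finset.sum_coe_sort s (fun v => (c v - c' v) • v)]
        simp only [sub_smul, Finset.sum_sub_distrib, h2, sub_self]) ⟨v, hv⟩ (Finset.mem_univ _)
  exact sub_eq_zero.1 this

omit [AddCommGroup E] [Module ℝ E] in
theorem Finset.sum_extend_zero {M : Type*} [AddCommMonoid M] [Module ℝ M] [DecidableEq E]
    {t s : Finset E} (h : t ⊆ s) (w : E → ℝ) (f : E → M) :
    ∑ v ∈ s, (if v ∈ t then w v else 0) • f v = ∑ v ∈ t, w v • f v := by
  rw [← Finset.sum_subset h (f := fun v => (if v ∈ t then w v else 0) • f v)]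
  · exact Finset.sum_congr rfl fun v hv => by simp [hv]
  · intro v _ hv; simp [hv]

theorem Finset.exists_weights_of_mem_convexHull_subset {t s : Finset E} (h : t ⊆ s) {x : E}
    (hx : x ∈ convexHull ℝ (t : Set E)) :
    ∃ w : E → ℝ, (∀ v, 0 ≤ w v) ∧ (∀ v ∉ t, w v = 0) ∧ ∑ v ∈ s, w v = 1 ∧
      ∑ v ∈ s, w v • v = x := by
  classical
  obtain ⟨w, hw, hw1, rfl⟩ := Finset.mem_convexHull'.1 hx
  refine ⟨fun v => if v ∈ t then w v else 0, fun v => ?_, fun v hv => by simp [hv], ?_, ?_⟩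
  · dsimp only
    split_ifs with h
    exacts [hw v h, le_rfl]
  · simpa [hw1] using Finset.sum_extend_zero h w (fun _ => (1 : ℝ))
  · exact Finset.sum_extend_zero h w id

/-- The faces of a simplex are extreme. -/
theorem isExtreme_convexHull_of_affineIndependent {s t : Finset E}
    (hs : AffineIndependent ℝ ((↑) : s → E)) (hts : t ⊆ s) :
    IsExtreme ℝ (convexHull ℝ (s : Set E)) (convexHull ℝ (t : Set E)) := by
  classical
  refine ⟨convexHull_mono (by exact_mod_cast hts), ?_⟩
  rintro a ha b hb z hz ⟨x, y, hx, hy, hxy, rfl⟩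
  obtain ⟨α, hα, hα1, rfl⟩ := Finset.mem_convexHull'.1 ha
  obtain ⟨β, hβ, hβ1, rfl⟩ := Finset.mem_convexHull'.1 hb
  obtain ⟨w, hw, hw0, hw1, hwz⟩ := Finset.exists_weights_of_mem_convexHull_subset hts hz
  have key := Finset.eq_of_sum_smul_eq hs (c := w) (c' := fun v => x * α v + y * β v)
    (by rw [hw1, Finset.sum_add_distrib, ← Finset.mul_sum, ← Finset.mul_sum, hα1, hβ1]; simp [hxy])
    (by rw [hwz]; simp only [add_smul, mul_smul, Finset.sum_add_distrib, Finset.smul_sum])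
  have h0 : ∀ v ∈ s, v ∉ t → α v = 0 := by
    intro v hv hvt
    have := key v hv
    rw [hw0 v hvt] at this
    have h1 := hα v hv
    have h2 := mul_nonneg hy.le (hβ v hv)
    by_contra h
    have := mul_pos hx (lt_of_le_of_ne h1 (Ne.symm h))
    linarith
  rw [Finset.mem_convexHull']
  refine ⟨α, fun v hv => hα v (hts hv), ?_, ?_⟩
  · rw [← hα1]; exact Finset.sum_subset hts h0
  · exact Finset.sum_subset hts fun v hv hvt => by rw [h0 v hv hvt, zero_smul]

theorem Finset.exists_pos_weights {s : Finset E} [DecidableEq E] {z : E}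
    (hz : z ∈ convexHull ℝ (s : Set E))
    (h : ∀ v ∈ s, z ∉ convexHull ℝ ((s.erase v : Finset E) : Set E)) :
    ∃ w : E → ℝ, (∀ v ∈ s, 0 < w v) ∧ ∑ v ∈ s, w v = 1 ∧ ∑ v ∈ s, w v • v = z := by
  obtain ⟨w, hw, hw1, rfl⟩ := Finset.mem_convexHull'.1 hz
  refine ⟨w, fun v hv => lt_of_le_of_ne (hw v hv) fun h0 => h v hv ?_, hw1, rfl⟩
  rw [Finset.mem_convexHull']
  refine ⟨w, fun u hu => hw u (Finset.mem_of_mem_erase hu), ?_, ?_⟩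
  · rw [← hw1, ← Finset.add_sum_erase _ _ hv, ← h0, zero_add]
  · rw [← Finset.add_sum_erase _ _ hv, ← h0, zero_smul, zero_add]

/-- A convex combination can be moved towards an affine combination that is nonnegative where the
convex combination vanishes. -/
theorem Finset.eventually_lineMap_mem_convexHull {s : Finset E} {w c : E → ℝ}
    (hw : ∀ v ∈ s, 0 ≤ w v) (hw1 : ∑ v ∈ s, w v = 1) (hc1 : ∑ v ∈ s, c v = 1)
    (hwc : ∀ v ∈ s, w v = 0 → 0 ≤ c v) :
    ∀ᶠ r in 𝓝[>] (0 : ℝ), lineMap (∑ v ∈ s, w v • v) (∑ v ∈ s, c v • v) r ∈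
      convexHull ℝ (s : Set E) := by
  have h : ∀ᶠ r in 𝓝[>] (0 : ℝ), ∀ v ∈ s, 0 ≤ lineMap (w v) (c v) r := by
    rw [Filter.eventually_all_finset]
    intro v hv
    rcases (hw v hv).eq_or_lt with h0 | hpos
    · filter_upwards [self_mem_nhdsWithin] with r hr
      have := hwc v hv h0.symm
      rw [lineMap_apply_module, ← h0]
      have : 0 ≤ r := le_of_lt hr
      simp only [smul_eq_mul, mul_zero, zero_add]
      positivity
    · filter_upwards [(tendsto_lineMap_zero (w v) (c v)).eventually (lt_mem_nhds hpos)] with r hr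
      exact hr.le
  filter_upwards [h] with r hr
  rw [Finset.mem_convexHull']
  refine ⟨fun v => lineMap (w v) (c v) r, hr, ?_, ?_⟩
  · simp only [lineMap_apply_module, smul_eq_mul, Finset.sum_add_distrib, ← Finset.mul_sum, hw1,
      hc1]
    ring
  · simp only [lineMap_apply_module, smul_eq_mul, add_smul, mul_smul, Finset.sum_add_distrib,
      Finset.smul_sum]

theorem Finset.eventually_lineMap_mem_convexHull_of_pos {s : Finset E} {w : E → ℝ} {a : E}
    (hw : ∀ v ∈ s, 0 < w v) (hw1 : ∑ v ∈ s, w v = 1) (ha : a ∈ affineSpan ℝ (s : Set E)) :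
    ∀ᶠ r in 𝓝[>] (0 : ℝ), lineMap (∑ v ∈ s, w v • v) a r ∈ convexHull ℝ (s : Set E) := by
  obtain ⟨c, hc1, rfl⟩ := Finset.exists_weights_of_mem_affineSpan ha
  exact Finset.eventually_lineMap_mem_convexHull (fun v hv => (hw v hv).le) hw1 hc1
    fun v hv h => absurd h (hw v hv).ne'

/-- Every point of a polytope is a positive convex combination of all the vertices of a face. -/
theorem exists_isHullFace_pos {n : ℕ} {C : Finset (EuclideanSpace ℝ (Fin n))}
    {z : EuclideanSpace ℝ (Fin n)} (hz : z ∈ convexHull ℝ (C : Set (EuclideanSpace ℝ (Fin n)))) :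
    ∃ F ⊆ C, F.Nonempty ∧ IsHullFace (F : Set (EuclideanSpace ℝ (Fin n))) C ∧
      ∃ w : EuclideanSpace ℝ (Fin n) → ℝ, (∀ v ∈ F, 0 < w v) ∧ ∑ v ∈ F, w v = 1 ∧
        ∑ v ∈ F, w v • v = z := by
  classical
  -- The face is found as a largest set of points of `C` that represents `z` with positive weights.
  let 𝓕 := C.powerset.filter fun F => ∃ w : EuclideanSpace ℝ (Fin n) → ℝ, (∀ v ∈ F, 0 < w v) ∧
    ∑ v ∈ F, w v = 1 ∧ ∑ v ∈ F, w v • v = z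
  have hne : 𝓕.Nonempty := by
    obtain ⟨w, hw, hw1, hwz⟩ := Finset.mem_convexHull'.1 hz
    have h0 : ∀ v ∈ C, v ∉ C.filter (fun v => 0 < w v) → w v = 0 := by
      intro v hv hvF
      simp only [Finset.mem_filter, hv, true_and, not_lt] at hvF
      exact le_antisymm hvF (hw v hv)
    refine ⟨C.filter fun v => 0 < w v, Finset.mem_filter.2 ⟨by simp, w, by simp, ?_, ?_⟩⟩
    · rw [← hw1]; exact Finset.sum_subset (by simp) h0
    · rw [← hwz]; exact Finset.sum_subset (by simp) fun v hv h => by rw [h0 v hv h, zero_smul]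
  obtain ⟨F, hF, hmax⟩ := 𝓕.exists_max_image Finset.card hne
  obtain ⟨hFC, w, hw, hw1, rfl⟩ := Finset.mem_filter.1 hF
  rw [Finset.mem_powerset] at hFC
  have key : ∀ γ : EuclideanSpace ℝ (Fin n) → ℝ, (∀ v ∈ C, 0 ≤ γ v) → ∑ v ∈ C, γ v = 1 →
      ∑ v ∈ C, γ v • v ∈ convexHull ℝ (F : Set (EuclideanSpace ℝ (Fin n))) →
      ∀ v ∈ C, 0 < γ v → v ∈ F := by
    intro γ hγ hγ1 hp
    set p := ∑ v ∈ C, γ v • v with hpdef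
    have hzF := Finset.sum_smul_mem_affineSpan hw1
    -- Continue from `p` through `z` to the point `z + r (z - p)`, still in the hull of `F`, with
    -- weights `ζ`. Then `ω + ζ + r γ`, divided by `2 + r`, represents `z` again and is positive on
    -- `F` and on the support of `γ`; maximality of `F` puts that support into `F`.
    obtain ⟨r, hr, hr01⟩ := ((Finset.eventually_lineMap_mem_convexHull_of_pos hw hw1
      (AffineMap.lineMap_mem (-1 : ℝ) hzF (convexHull_subset_affineSpan _ hp))).and
      eventually_mem_Ioo_zero_one).exists
    obtain ⟨ζ, hζ, hζ0, hζ1, hζz⟩ := Finset.exists_weights_of_mem_convexHull_subset hFC hr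
    set z := ∑ v ∈ F, w v • v with hzdef
    let ω : EuclideanSpace ℝ (Fin n) → ℝ := fun v => if v ∈ F then w v else 0
    have hω1 : ∑ v ∈ C, ω v = 1 := by
      simpa only [smul_eq_mul, mul_one, hw1] using Finset.sum_extend_zero hFC w fun _ => (1 : ℝ)
    have hωz : ∑ v ∈ C, ω v • v = z := Finset.sum_extend_zero hFC w id
    let μ : EuclideanSpace ℝ (Fin n) → ℝ := fun v => (1 / (2 + r)) * (ω v + ζ v + r * γ v)
    have hr0 := hr01.1
    have hω0 : ∀ v, 0 ≤ ω v := fun v => by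
      simp only [ω]
      split_ifs with h
      exacts [(hw v h).le, le_rfl]
    let G := C.filter fun v => 0 < μ v
    have hμ0 : ∀ v ∈ C, 0 ≤ μ v := fun v hv => by
      have := hω0 v; have := hζ v; have := hγ v hv
      simp only [μ]; positivity
    have hμ1 : ∑ v ∈ C, μ v = 1 := by
      simp only [μ, ← Finset.mul_sum, Finset.sum_add_distrib, hω1, hζ1, hγ1]
      field_simp
      ring
    have hμz : ∑ v ∈ C, μ v • v = z := by
      simp only [μ, mul_smul, add_smul, ← Finset.smul_sum, Finset.sum_add_distrib, hωz, hζz,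
        ← hpdef]
      simp only [lineMap_apply_module]
      match_scalars <;> field_simp <;> ring
    have hout : ∀ v ∈ C, v ∉ G → μ v = 0 := by
      intro v hv hvG
      simp only [G, Finset.mem_filter, hv, true_and, not_lt] at hvG
      exact le_antisymm hvG (hμ0 v hv)
    have hG : G ∈ 𝓕 := by
      refine Finset.mem_filter.2 ⟨by simp [G], μ, by simp [G], ?_, ?_⟩
      · rw [← hμ1]; exact Finset.sum_subset (by simp [G]) hout
      · rw [← hzdef, ← hμz]
        exact Finset.sum_subset (by simp [G]) fun v hv h => by rw [hout v hv h, zero_smul]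
    have hFG : F ⊆ G := by
      intro v hv
      have h1 := hζ v; have h2 := hγ v (hFC hv); have h3 := hw v hv
      simp only [G, μ, ω, Finset.mem_filter, hv, if_true, hFC hv, true_and]
      positivity
    have hGF : F = G := Finset.eq_of_subset_of_card_le hFG (hmax G hG)
    intro v hv hγv
    rw [hGF]
    have h1 := hζ v; have h2 := hω0 v
    simp only [G, μ, Finset.mem_filter, hv, true_and]
    positivity
  refine ⟨F, hFC, ?_, ⟨by exact_mod_cast hFC, ⟨convexHull_mono (by exact_mod_cast hFC), ?_⟩, ?_⟩,
    w, hw, hw1, rfl⟩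
  · by_contra h
    rw [Finset.not_nonempty_iff_eq_empty] at h
    simp [h] at hw1
  · rintro a ha b hb p hp ⟨x, y, hx, hy, hxy, rfl⟩
    obtain ⟨α, hα, hα1, rfl⟩ := Finset.mem_convexHull'.1 ha
    obtain ⟨β, hβ, hβ1, rfl⟩ := Finset.mem_convexHull'.1 hb
    have hsupp := key (fun v => x * α v + y * β v)
      (fun v hv => by have := hα v hv; have := hβ v hv; positivity)
      (by rw [Finset.sum_add_distrib, ← Finset.mul_sum, ← Finset.mul_sum, hα1, hβ1]; simp [hxy])
      (by simpa only [add_smul, mul_smul, Finset.sum_add_distrib, Finset.smul_sum] using hp)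
    have h0 : ∀ v ∈ C, v ∉ F → α v = 0 := by
      intro v hv hvF
      by_contra h
      have h1 := mul_pos hx (lt_of_le_of_ne (hα v hv) (Ne.symm h))
      have h2 := mul_nonneg hy.le (hβ v hv)
      exact hvF (hsupp v hv (by linarith))
    rw [Finset.mem_convexHull']
    refine ⟨α, fun v hv => hα v (hFC hv), ?_, ?_⟩
    · rw [← hα1]; exact Finset.sum_subset hFC h0
    · exact Finset.sum_subset hFC fun v hv hvt => by rw [h0 v hv hvt, zero_smul]
  · intro v hv hvF
    refine key (Pi.single v 1) (fun u _ => ?_) ?_ ?_ v hv (by simp)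
    · by_cases h : u = v
      · subst h; simp
      · simp [h]
    · simpa using hv
    · rw [Finset.sum_eq_single_of_mem v (by exact_mod_cast hv)]
      · simpa using hvF
      · intro u _ hu; simp [hu]

end Weights

/-! ### Relative boundary and nearby points of the affine span. -/

section Intrinsic

variable {E : Type*} [NormedAddCommGroup E] [NormedSpace ℝ E]

theorem exists_notMem_of_mem_intrinsicFrontier {K : Set E} {x : E}
    (hx : x ∈ intrinsicFrontier ℝ K) {U : Set E} (hU : U ∈ 𝓝 x) :
    ∃ y ∈ affineSpan ℝ K, y ∈ U ∧ y ∉ K := by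
  obtain ⟨y, hy, rfl⟩ := mem_intrinsicFrontier.1 hx
  rw [frontier_eq_closure_inter_closure] at hy
  obtain ⟨z, hzU, hzK⟩ := mem_closure_iff_nhds.1 hy.2 ((↑) ⁻¹' U)
    (continuous_subtype_val.continuousAt.preimage_mem_nhds hU)
  exact ⟨z, z.2, hzU, hzK⟩

theorem eventually_mem_of_notMem_intrinsicFrontier {K : Set E} {x : E} (hxK : x ∈ K)
    (hx : x ∉ intrinsicFrontier ℝ K) : ∀ᶠ y in 𝓝 x, y ∈ affineSpan ℝ K → y ∈ K := by
  have hxi : x ∈ intrinsicInterior ℝ K := by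
    have := subset_intrinsicClosure (𝕜 := ℝ) hxK
    rw [← intrinsicInterior_union_intrinsicFrontier] at this
    exact this.resolve_right hx
  obtain ⟨y, hy, rfl⟩ := mem_intrinsicInterior.1 hxi
  rw [mem_interior_iff_mem_nhds, nhds_subtype, mem_comap] at hy
  obtain ⟨U, hU, hUK⟩ := hy
  filter_upwards [hU] with z hz hzA
  exact hUK (show (⟨z, hzA⟩ : affineSpan ℝ K) ∈ _ from hz)

end Intrinsic

/-! ### Dimension counts and general position. -/

section Dimension

variable {E : Type*} [NormedAddCommGroup E] [NormedSpace ℝ E] [FiniteDimensional ℝ E]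

theorem AffineSubspace.eq_of_le_of_finrank_le {B C : AffineSubspace ℝ E} (hB : (B : Set E).Nonempty)
    (h : B ≤ C) (hd : Module.finrank ℝ C.direction ≤ Module.finrank ℝ B.direction) : B = C :=
  AffineSubspace.eq_of_direction_eq_of_nonempty_of_le
    (Submodule.eq_of_le_of_finrank_le (AffineSubspace.direction_le h) hd) hB h

theorem AffineSubspace.eq_of_lt_of_le {B C A : AffineSubspace ℝ E} (hB : (B : Set E).Nonempty)
    (hBC : B < C) (hCA : C ≤ A)
    (hd : Module.finrank ℝ A.direction ≤ Module.finrank ℝ B.direction + 1) : C = A := by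
  have := Submodule.finrank_lt_finrank_of_lt (AffineSubspace.direction_lt_of_nonempty hBC hB)
  exact AffineSubspace.eq_of_le_of_finrank_le (hB.mono hBC.le) hCA (by omega)

/-- Applied to a generic point: a set of at most `d` vertices cannot span a `d`-dimensional `A`, so
its affine span misses the point. -/
theorem finrank_direction_lt_card {A : AffineSubspace ℝ E} (hA : (A : Set E).Nonempty)
    {G : Finset E} (h : A ≤ affineSpan ℝ (G : Set E)) : Module.finrank ℝ A.direction < G.card := by
  have hG : G.Nonempty := by
    obtain ⟨a, ha⟩ := hA
    exact_mod_cast (affineSpan_nonempty ℝ (s := (G : Set E))).1 ⟨a, h ha⟩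
  have := hG.to_subtype
  have h1 := Submodule.finrank_mono (AffineSubspace.direction_le h)
  have h2 := finrank_vectorSpan_range_add_one_le ℝ ((↑) : G → E)
  rw [direction_affineSpan] at h1
  rw [Fintype.card_coe, show Set.range ((↑) : G → E) = G from Subtype.range_coe] at h2
  omega

omit [FiniteDimensional ℝ E] in
theorem Finset.card_eq_finrank_add_one {s : Finset E} (hs : AffineIndependent ℝ ((↑) : s → E))
    (hne : s.Nonempty) :
    s.card = Module.finrank ℝ (affineSpan ℝ (s : Set E)).direction + 1 := by
  have := hne.to_subtype
  have h := hs.finrank_vectorSpan_add_one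
  rw [Fintype.card_coe, show Set.range ((↑) : s → E) = s from Subtype.range_coe] at h
  rw [direction_affineSpan, h]

omit [FiniteDimensional ℝ E] in
theorem Finset.mem_of_mem_affineSpan {s t : Finset E} (hs : AffineIndependent ℝ ((↑) : s → E))
    (hts : t ⊆ s) {v : E} (hv : v ∈ s) (h : v ∈ affineSpan ℝ (t : Set E)) : v ∈ t := by
  have h1 := hs.mem_affineSpan_iff ⟨v, hv⟩ {u | (u : E) ∈ t}
  have h2 : ((↑) : s → E) '' {u | (u : E) ∈ t} = t := by
    ext u
    simp only [Set.mem_image, Set.mem_ofPred_eq, Subtype.exists, Finset.mem_coe]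
    exact ⟨by rintro ⟨a, -, ha, rfl⟩; exact ha, fun hu => ⟨u, hts hu, hu, rfl⟩⟩
  rw [h2] at h1
  exact h1.1 h

omit [FiniteDimensional ℝ E] in
theorem AffineSubspace.nonempty_of_affineSpan_eq {s : Finset E} (hs : s.Nonempty)
    {A : AffineSubspace ℝ E} (h : affineSpan ℝ (s : Set E) = A) : (A : Set E).Nonempty := by
  rw [← h]
  exact (affineSpan_nonempty ℝ).2 (by exact_mod_cast hs)

/-- `y` lies in general position with respect to `X` in `A`: every subset of `X` whose affine span
contains `y` spans the whole of `A`. -/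
def IsGenericIn (X : Set E) (A : AffineSubspace ℝ E) (y : E) : Prop :=
  ∀ G : Finset E, (G : Set E) ⊆ X → y ∈ affineSpan ℝ (G : Set E) → A ≤ affineSpan ℝ (G : Set E)

omit [FiniteDimensional ℝ E] in
theorem finite_affineSpans {X : Set E} (hX : X.Finite) :
    {B : AffineSubspace ℝ E | ∃ G : Finset E, (G : Set E) ⊆ X ∧ affineSpan ℝ (G : Set E) = B}.Finite := by
  refine (hX.powerset.image (affineSpan ℝ)).subset ?_
  rintro B ⟨G, hG, rfl⟩
  exact ⟨G, hG, rfl⟩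

theorem Convex.exists_isGenericIn {K : Set E} (hK : Convex ℝ K) (hne : K.Nonempty) {X : Set E}
    (hX : X.Finite) : ∃ z ∈ K, IsGenericIn X (affineSpan ℝ K) z := by
  obtain ⟨z, hz, h⟩ := hK.exists_generic hne (finite_affineSpans hX)
  exact ⟨z, hz, fun G hG hzG => affineSpan_le.2 (h _ ⟨G, hG, rfl⟩ hzG)⟩

/-- The finitely many spans that `b` avoids each meet the line through `x` and `b` at most once. So
any point `x` has generic points arbitrarily near it on the way to `b`. -/
theorem IsGenericIn.eventually_lineMap {X : Set E} (hX : X.Finite) {A : AffineSubspace ℝ E} {b : E}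
    (hb : IsGenericIn X A b) (x : E) : ∀ᶠ r in 𝓝[>] (0 : ℝ), IsGenericIn X A (lineMap x b r) := by
  have := (eventually_all_finite (finite_affineSpans hX)
    (l := 𝓝[>] (0 : ℝ)) (p := fun B r => b ∉ B → lineMap x b r ∉ B)).2 fun B _ => by
      by_cases h : b ∈ B
      · exact Eventually.of_forall fun _ h' => absurd h h'
      · filter_upwards [AffineSubspace.eventually_lineMap_notMem h x] with r hr _ using hr
  filter_upwards [this] with r hr G hG hz
  by_contra hA
  exact hr _ ⟨G, hG, rfl⟩ (fun h => hA (hb G hG h)) hz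

end Dimension

/-! ### Simplices of the triangulation that span a `d`-dimensional subspace. -/

section Complex

variable {n d : ℕ} {P : Polytope n d} {T : Geometry.SimplicialComplex ℝ (EuclideanSpace ℝ (Fin n))}

theorem Polytope.finite_vertices (P : Polytope n d) : P.vertices.Finite := by
  have : P.vertices = ⋃ C ∈ P.cells, (C : Set (EuclideanSpace ℝ (Fin n))) := by
    ext v; simp [Polytope.vertices]
  rw [this]
  exact P.finite_cells.biUnion fun C _ => C.finite_toSet

theorem Polytope.coe_subset_vertices {C : Finset (EuclideanSpace ℝ (Fin n))} (hC : C ∈ P.cells) :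
    (C : Set (EuclideanSpace ℝ (Fin n))) ⊆ P.vertices :=
  fun _ hv => ⟨C, hC, hv⟩

theorem Polytope.mem_space_iff {x : EuclideanSpace ℝ (Fin n)} : x ∈ P.space ↔
    ∃ C ∈ P.cells, x ∈ convexHull ℝ (C : Set (EuclideanSpace ℝ (Fin n))) := by
  simp [Polytope.space]

theorem Polytope.affineSpan_eq_of_le {A : AffineSubspace ℝ (EuclideanSpace ℝ (Fin n))}
    (hA : (A : Set (EuclideanSpace ℝ (Fin n))).Nonempty) (hAd : Module.finrank ℝ A.direction = d)
    {D : Finset (EuclideanSpace ℝ (Fin n))} (hD : D ∈ P.cells)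
    (h : A ≤ affineSpan ℝ (D : Set (EuclideanSpace ℝ (Fin n)))) :
    affineSpan ℝ (D : Set (EuclideanSpace ℝ (Fin n))) = A := by
  refine (AffineSubspace.eq_of_le_of_finrank_le hA h ?_).symm
  rw [direction_affineSpan, hAd]
  exact P.dim_le D hD

theorem Geometry.SimplicialComplex.finite_vertices (hT : T.faces.Finite) : T.vertices.Finite := by
  rw [Geometry.SimplicialComplex.vertices_eq]
  exact hT.biUnion fun C _ => C.finite_toSet

theorem Geometry.SimplicialComplex.coe_subset_vertices {s : Finset (EuclideanSpace ℝ (Fin n))}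
    (hs : s ∈ T.faces) : (s : Set (EuclideanSpace ℝ (Fin n))) ⊆ T.vertices := by
  rw [Geometry.SimplicialComplex.vertices_eq]
  exact Set.subset_biUnion_of_mem (u := fun s : Finset _ => (s : Set (EuclideanSpace ℝ (Fin n)))) hs

/-- Every point of a simplex of the triangulation lies in a cell whose affine span contains the
simplex. -/
theorem IsTriangulation.exists_cell (hT : IsTriangulation P T)
    {σ : Finset (EuclideanSpace ℝ (Fin n))} (hσ : σ ∈ T.faces) {p : EuclideanSpace ℝ (Fin n)}
    (hp : p ∈ convexHull ℝ (σ : Set (EuclideanSpace ℝ (Fin n)))) :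
    ∃ D ∈ P.cells, p ∈ convexHull ℝ (D : Set (EuclideanSpace ℝ (Fin n))) ∧
      affineSpan ℝ (σ : Set (EuclideanSpace ℝ (Fin n))) ≤ affineSpan ℝ D := by
  obtain ⟨b, hb, hgen⟩ := (convex_convexHull ℝ (σ : Set (EuclideanSpace ℝ (Fin n)))).exists_isGenericIn
    ⟨p, hp⟩ P.finite_vertices
  rw [affineSpan_convexHull] at hgen
  obtain ⟨r, hr, hr01⟩ := ((eventually_mem_of_lineMap_mem P.finite_cells
    (S := fun D => convexHull ℝ (D : Set (EuclideanSpace ℝ (Fin n))))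
    (fun D _ => D.isClosed_convexHull_coe) p b).and eventually_mem_Ioo_zero_one).exists
  have hmem : lineMap p b r ∈ P.space := by
    rw [← hT.space_eq, Geometry.SimplicialComplex.mem_space_iff]
    exact ⟨σ, hσ, (convex_convexHull ℝ _).lineMap_mem hp hb ⟨hr01.1.le, hr01.2.le⟩⟩
  obtain ⟨D, hD, hrD⟩ := Polytope.mem_space_iff.1 hmem
  have hpD := hr D hD hrD
  refine ⟨D, hD, hpD, hgen D (P.coe_subset_vertices hD) ?_⟩
  -- The span of `D` contains two points of the line through `p` and `b`, hence the generic point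
  -- `b`.
  exact AffineSubspace.mem_of_lineMap_mem hr01.1.ne' (convexHull_subset_affineSpan _ hpD)
    (convexHull_subset_affineSpan _ hrD)

open Classical in
/-- The simplices of `T` that span the affine subspace `A`. -/
noncomputable def IsTriangulation.spanning (hT : IsTriangulation P T)
    (A : AffineSubspace ℝ (EuclideanSpace ℝ (Fin n))) :
    Finset (Finset (EuclideanSpace ℝ (Fin n))) :=
  hT.finite.toFinset.filter fun σ => affineSpan ℝ (σ : Set (EuclideanSpace ℝ (Fin n))) = A

variable {hT : IsTriangulation P T} {A : AffineSubspace ℝ (EuclideanSpace ℝ (Fin n))}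
  {σ τ ρ : Finset (EuclideanSpace ℝ (Fin n))} {y z : EuclideanSpace ℝ (Fin n)}

theorem IsTriangulation.mem_spanning : σ ∈ hT.spanning A ↔
    σ ∈ T.faces ∧ affineSpan ℝ (σ : Set (EuclideanSpace ℝ (Fin n))) = A := by
  simp [IsTriangulation.spanning]

theorem IsTriangulation.card_of_mem_spanning (hAd : Module.finrank ℝ A.direction = d)
    (hσ : σ ∈ hT.spanning A) : σ.card = d + 1 := by
  obtain ⟨hσ, h⟩ := IsTriangulation.mem_spanning.1 hσ
  rw [Finset.card_eq_finrank_add_one (T.indep hσ) (T.nonempty_of_mem_faces hσ), h, hAd]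

theorem IsTriangulation.mem_spanning_of_le (hA : (A : Set (EuclideanSpace ℝ (Fin n))).Nonempty)
    (hAd : Module.finrank ℝ A.direction = d) (hσ : σ ∈ T.faces)
    (h : A ≤ affineSpan ℝ (σ : Set (EuclideanSpace ℝ (Fin n)))) : σ ∈ hT.spanning A := by
  refine IsTriangulation.mem_spanning.2 ⟨hσ, le_antisymm ?_ h⟩
  obtain ⟨v, hv⟩ := T.nonempty_of_mem_faces hσ
  obtain ⟨D, hD, -, hle⟩ := hT.exists_cell hσ (subset_convexHull ℝ _ hv)
  exact hle.trans (P.affineSpan_eq_of_le hA hAd hD (h.trans hle)).le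

/-- A point in general position lies in at most one of the simplices spanning `A`. -/
theorem IsTriangulation.eq_of_mem_of_isGenericIn
    (hA : (A : Set (EuclideanSpace ℝ (Fin n))).Nonempty) (hAd : Module.finrank ℝ A.direction = d)
    {X : Set (EuclideanSpace ℝ (Fin n))} (hX : T.vertices ⊆ X) (hy : IsGenericIn X A y)
    (hσ : σ ∈ hT.spanning A) (hτ : τ ∈ hT.spanning A)
    (hyσ : y ∈ convexHull ℝ (σ : Set (EuclideanSpace ℝ (Fin n))))
    (hyτ : y ∈ convexHull ℝ (τ : Set (EuclideanSpace ℝ (Fin n)))) : σ = τ := by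
  classical
  have h1 := IsTriangulation.mem_spanning.1 hσ
  have h2 := IsTriangulation.mem_spanning.1 hτ
  have h := T.inter_subset_convexHull h1.1 h2.1 ⟨hyσ, hyτ⟩
  rw [← Finset.coe_inter] at h
  -- The common face contains the generic point `y`, so it spans `A` and has all `d + 1` vertices.
  have hle := hy (σ ∩ τ) (subset_trans (by simp) ((T.coe_subset_vertices h1.1).trans hX))
    (convexHull_subset_affineSpan _ h)
  have hc := finrank_direction_lt_card hA hle
  have e1 := Finset.eq_of_subset_of_card_le (Finset.inter_subset_left (s₁ := σ) (s₂ := τ))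
    (by rw [IsTriangulation.card_of_mem_spanning hAd hσ]; omega)
  have e2 := Finset.eq_of_subset_of_card_le (Finset.inter_subset_right (s₁ := σ) (s₂ := τ))
    (by rw [IsTriangulation.card_of_mem_spanning hAd hτ]; omega)
  exact e1.symm.trans e2

/-- Two spanning simplices with a common facet that share a point off this facet coincide. -/
theorem IsTriangulation.eq_of_facet_subset (hAd : Module.finrank ℝ A.direction = d)
    (hρ : ρ.card = d) (hσ : σ ∈ hT.spanning A) (hτ : τ ∈ hT.spanning A) (hρσ : ρ ⊆ σ) (hρτ : ρ ⊆ τ)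
    (hy : y ∉ convexHull ℝ (ρ : Set (EuclideanSpace ℝ (Fin n))))
    (hyσ : y ∈ convexHull ℝ (σ : Set (EuclideanSpace ℝ (Fin n))))
    (hyτ : y ∈ convexHull ℝ (τ : Set (EuclideanSpace ℝ (Fin n)))) : σ = τ := by
  classical
  have h1 := IsTriangulation.mem_spanning.1 hσ
  have h2 := IsTriangulation.mem_spanning.1 hτ
  have h := T.inter_subset_convexHull h1.1 h2.1 ⟨hyσ, hyτ⟩
  rw [← Finset.coe_inter] at h
  have hsub : ρ ⊆ σ ∩ τ := Finset.subset_inter hρσ hρτ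
  have hlt : d < (σ ∩ τ).card := by
    rw [← hρ]
    refine Finset.card_lt_card (hsub.ssubset_of_ne ?_)
    rintro e
    exact hy (e ▸ h)
  have e1 := Finset.eq_of_subset_of_card_le (Finset.inter_subset_left (s₁ := σ) (s₂ := τ))
    (by rw [IsTriangulation.card_of_mem_spanning hAd hσ]; omega)
  have e2 := Finset.eq_of_subset_of_card_le (Finset.inter_subset_right (s₁ := σ) (s₂ := τ))
    (by rw [IsTriangulation.card_of_mem_spanning hAd hτ]; omega)
  exact e1.symm.trans e2

/-- Let `u` be the vertex of `σ` opposite to `ρ`. All weights of `z` on `ρ` are positive, so only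
the sign of the coordinate of `a` at `u` decides whether a short move towards `a` stays in `σ`. If
it is negative, the reflection of `a` in `z`, with coordinates `2 ω - c`, has a positive one. -/
theorem IsTriangulation.eventually_mem_side (hAd : Module.finrank ℝ A.direction = d)
    (hρ : ρ.card = d) (hσ : σ ∈ hT.spanning A) (hρσ : ρ ⊆ σ) {w : EuclideanSpace ℝ (Fin n) → ℝ}
    (hw : ∀ v ∈ ρ, 0 < w v) (hw1 : ∑ v ∈ ρ, w v = 1) (hwz : ∑ v ∈ ρ, w v • v = z)
    {a : EuclideanSpace ℝ (Fin n)} (ha : a ∈ A) :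
    (∀ᶠ r in 𝓝[>] (0 : ℝ), lineMap z a r ∈ convexHull ℝ (σ : Set (EuclideanSpace ℝ (Fin n)))) ∨
    (∀ᶠ r in 𝓝[>] (0 : ℝ), lineMap z (lineMap z a (-1 : ℝ)) r ∈
      convexHull ℝ (σ : Set (EuclideanSpace ℝ (Fin n)))) := by
  classical
  obtain ⟨u, hu, rfl⟩ := Finset.exists_eq_insert_iff.2
    ⟨hρσ, by rw [hρ, IsTriangulation.card_of_mem_spanning hAd hσ]⟩
  rw [← (IsTriangulation.mem_spanning.1 hσ).2] at ha
  obtain ⟨c, hc1, rfl⟩ := Finset.exists_weights_of_mem_affineSpan ha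
  let ω : EuclideanSpace ℝ (Fin n) → ℝ := fun v => if v ∈ ρ then w v else 0
  have hω1 : ∑ v ∈ insert u ρ, ω v = 1 := by
    simpa only [smul_eq_mul, mul_one, hw1] using
      Finset.sum_extend_zero (Finset.subset_insert u ρ) w fun _ => (1 : ℝ)
  have hωz : ∑ v ∈ insert u ρ, ω v • v = z :=
    (Finset.sum_extend_zero (Finset.subset_insert u ρ) w id).trans hwz
  have hω0 : ∀ v ∈ insert u ρ, 0 ≤ ω v := by
    intro v _
    simp only [ω]
    split_ifs with h
    exacts [(hw v h).le, le_rfl]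
  have hωu : ∀ v ∈ insert u ρ, ω v = 0 → v = u := by
    intro v hv h
    by_contra hne
    have hvρ := Finset.mem_of_mem_insert_of_ne hv hne
    simp only [ω, hvρ, if_true] at h
    exact (hw v hvρ).ne' h
  have hωu0 : ω u = 0 := by simp [ω, hu]
  rcases le_total 0 (c u) with h | h
  · left
    have := Finset.eventually_lineMap_mem_convexHull hω0 hω1 hc1
      fun v hv h0 => by rw [hωu v hv h0]; exact h
    rwa [hωz] at this
  · right
    have := Finset.eventually_lineMap_mem_convexHull (c := fun v => 2 * ω v - c v) hω0 hω1
      (by rw [Finset.sum_sub_distrib, ← Finset.mul_sum, hω1, hc1]; norm_num)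
      fun v hv h0 => by rw [hωu v hv h0, hωu0]; linarith
    rw [hωz] at this
    have e : ∑ v ∈ insert u ρ, (2 * ω v - c v) • v =
        lineMap z (∑ v ∈ insert u ρ, c v • v) (-1 : ℝ) := by
      simp only [sub_smul, mul_smul, Finset.sum_sub_distrib, ← Finset.smul_sum, hωz,
        lineMap_apply_module]
      module
    rwa [e] at this

/-- A facet of a spanning simplex is a facet of an even number of them, unless each of its vertices
lies in a cell of `P` that is contained in its affine span. -/
theorem IsTriangulation.even_card_spanning_facet [DecidableEq (EuclideanSpace ℝ (Fin n))]
    (hAd : Module.finrank ℝ A.direction = d)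
    (hσ : σ ∈ hT.spanning A) (hρσ : ρ ⊆ σ) (hρ : ρ.card = d) {v : EuclideanSpace ℝ (Fin n)}
    (hv : v ∈ ρ) (hcell : ∀ F ∈ P.cells, v ∈ convexHull ℝ (F : Set (EuclideanSpace ℝ (Fin n))) →
      ¬ affineSpan ℝ (F : Set (EuclideanSpace ℝ (Fin n))) ≤ affineSpan ℝ ρ) :
    Even ((hT.spanning A).filter fun τ => ρ ⊆ τ).card := by
  obtain ⟨hσT, hσA⟩ := IsTriangulation.mem_spanning.1 hσ
  have hA := AffineSubspace.nonempty_of_affineSpan_eq (T.nonempty_of_mem_faces hσT) hσA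
  have hρne : ρ.Nonempty := ⟨v, hv⟩
  have hρT := T.down_closed hσT hρσ hρne
  have hρA : affineSpan ℝ (ρ : Set (EuclideanSpace ℝ (Fin n))) ≤ A := by
    rw [← hσA]; exact affineSpan_mono ℝ (by exact_mod_cast hρσ)
  have hρspan : ((affineSpan ℝ (ρ : Set (EuclideanSpace ℝ (Fin n))) :
      AffineSubspace ℝ (EuclideanSpace ℝ (Fin n))) : Set (EuclideanSpace ℝ (Fin n))).Nonempty :=
    (affineSpan_nonempty ℝ).2 (by exact_mod_cast hρne)
  have hρdim := Finset.card_eq_finrank_add_one (T.indep hρT) hρne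
  -- The span of `ρ` is a hyperplane of `A`, so nothing lies strictly between them.
  have hlt_eq : ∀ B : AffineSubspace ℝ (EuclideanSpace ℝ (Fin n)),
      affineSpan ℝ (ρ : Set (EuclideanSpace ℝ (Fin n))) ≤ B → B ≤ A →
      ¬ B ≤ affineSpan ℝ (ρ : Set (EuclideanSpace ℝ (Fin n))) → B = A := fun B h1 h2 h3 =>
    AffineSubspace.eq_of_lt_of_le hρspan (lt_of_le_not_ge h1 h3) h2 (by omega)
  -- a point of `ρ` in general position, near `v`
  have hX : (T.vertices ∪ P.vertices).Finite :=
    (T.finite_vertices hT.finite).union P.finite_vertices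
  obtain ⟨b, hb, hbgen⟩ := (convex_convexHull ℝ (ρ : Set (EuclideanSpace ℝ (Fin n)))).exists_isGenericIn
    ⟨v, subset_convexHull ℝ _ hv⟩ hX
  rw [affineSpan_convexHull] at hbgen
  obtain ⟨z, hzρ, hzgen, hzcell⟩ : ∃ z ∈ convexHull ℝ (ρ : Set (EuclideanSpace ℝ (Fin n))),
      IsGenericIn (T.vertices ∪ P.vertices) (affineSpan ℝ (ρ : Set (EuclideanSpace ℝ (Fin n)))) z ∧
      ∀ F ∈ P.cells, z ∈ convexHull ℝ (F : Set (EuclideanSpace ℝ (Fin n))) →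
        ¬ affineSpan ℝ (F : Set (EuclideanSpace ℝ (Fin n))) ≤ affineSpan ℝ ρ := by
    obtain ⟨r, ⟨hr1, hr2⟩, hr3⟩ := (((hbgen.eventually_lineMap hX v).and
      (eventually_mem_of_lineMap_mem P.finite_cells
        (S := fun D => convexHull ℝ (D : Set (EuclideanSpace ℝ (Fin n))))
        (fun D _ => D.isClosed_convexHull_coe) v b)).and eventually_mem_Ioo_zero_one).exists
    exact ⟨lineMap v b r, (convex_convexHull ℝ _).lineMap_mem (subset_convexHull ℝ _ hv) hb
      ⟨hr3.1.le, hr3.2.le⟩, hr1, fun F hF hrF => hcell F hF (hr2 F hF hrF)⟩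
  -- the point lies in the relative interior of a `d`-cell in `A`
  obtain ⟨D, hD, hzD, hσD⟩ := hT.exists_cell hσT (convexHull_mono (by exact_mod_cast hρσ) hzρ)
  have hDA := P.affineSpan_eq_of_le hA hAd hD (hσA ▸ hσD)
  obtain ⟨F, hFD, hFne, hface, ω, hω, hω1, hωz⟩ := exists_isHullFace_pos hzD
  have hF := P.face_mem D hD F hFne hface
  have hzF : z ∈ convexHull ℝ (F : Set (EuclideanSpace ℝ (Fin n))) :=
    Finset.mem_convexHull'.2 ⟨ω, fun v hv => (hω v hv).le, hω1, hωz⟩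
  have hFA : affineSpan ℝ (F : Set (EuclideanSpace ℝ (Fin n))) = A := by
    refine hlt_eq _ (hzgen F ((P.coe_subset_vertices hF).trans Set.subset_union_right)
      (convexHull_subset_affineSpan _ hzF)) ?_ (hzcell F hF hzF)
    rw [← hDA]; exact affineSpan_mono ℝ (by exact_mod_cast hFD)
  have hin : ∀ a ∈ A, ∀ᶠ r in 𝓝[>] (0 : ℝ), lineMap z a r ∈ T.space := by
    intro a ha
    rw [← hFA] at ha
    filter_upwards [Finset.eventually_lineMap_mem_convexHull_of_pos hω hω1 ha] with r hr
    rw [hωz] at hr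
    rw [hT.space_eq]
    exact Polytope.mem_space_iff.2 ⟨F, hF, hr⟩
  -- `z` is a positive combination of the vertices of `ρ`
  have hsubρ : ∀ t ⊆ ρ, z ∈ convexHull ℝ (t : Set (EuclideanSpace ℝ (Fin n))) → ρ ⊆ t := by
    intro t ht hzt u hu
    have := hzgen t (subset_trans (by exact_mod_cast ht)
      ((T.coe_subset_vertices hρT).trans Set.subset_union_left)) (convexHull_subset_affineSpan _ hzt)
    exact Finset.mem_of_mem_affineSpan (T.indep hρT) ht hu (this (subset_affineSpan ℝ _ hu))
  obtain ⟨w, hw, hw1, hwz⟩ := Finset.exists_pos_weights hzρ fun u hu h =>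
    Finset.notMem_erase u ρ (hsubρ _ (Finset.erase_subset _ _) h hu)
  -- points on both sides of `ρ`
  have hzspan := convexHull_subset_affineSpan _ hzρ
  obtain ⟨a, haσ, haρ⟩ : ∃ a ∈ σ, a ∉ ρ := by
    by_contra! h
    have := Finset.card_le_card (show σ ⊆ ρ from h)
    rw [IsTriangulation.card_of_mem_spanning hAd hσ] at this
    omega
  have haA : a ∈ A := hσA ▸ subset_affineSpan ℝ _ haσ
  have haspan : a ∉ affineSpan ℝ (ρ : Set (EuclideanSpace ℝ (Fin n))) := fun h =>
    haρ (Finset.mem_of_mem_affineSpan (T.indep hσT) hρσ haσ h)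
  have haA' : lineMap z a (-1 : ℝ) ∈ A := AffineMap.lineMap_mem _ (hρA hzspan) haA
  have haspan' : lineMap z a (-1 : ℝ) ∉ affineSpan ℝ (ρ : Set (EuclideanSpace ℝ (Fin n))) :=
    fun h => haspan (AffineSubspace.mem_of_lineMap_mem (by norm_num) hzspan h)
  have hclosed : ∀ a, ∀ᶠ r in 𝓝[>] (0 : ℝ), ∀ s ∈ T.faces,
      lineMap z a r ∈ convexHull ℝ (s : Set (EuclideanSpace ℝ (Fin n))) →
      z ∈ convexHull ℝ (s : Set (EuclideanSpace ℝ (Fin n))) := fun a =>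
    eventually_mem_of_lineMap_mem hT.finite
      (S := fun D => convexHull ℝ (D : Set (EuclideanSpace ℝ (Fin n))))
      (fun D _ => D.isClosed_convexHull_coe) z a
  have hsides : ∀ᶠ r in 𝓝[>] (0 : ℝ), ∀ τ ∈ (hT.spanning A).filter fun τ => ρ ⊆ τ,
      lineMap z a r ∈ convexHull ℝ (τ : Set (EuclideanSpace ℝ (Fin n))) ∨
      lineMap z (lineMap z a (-1 : ℝ)) r ∈
        convexHull ℝ (τ : Set (EuclideanSpace ℝ (Fin n))) := by
    rw [Filter.eventually_all_finset]
    intro τ hτ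
    rw [Finset.mem_filter] at hτ
    rcases IsTriangulation.eventually_mem_side hAd hρ hτ.1 hτ.2 hw hw1 hwz haA with h | h
    · filter_upwards [h] with r hr using Or.inl hr
    · filter_upwards [h] with r hr using Or.inr hr
  obtain ⟨r, ⟨⟨⟨⟨⟨hr01, hs⟩, hi⟩, hi'⟩, hc⟩, hc'⟩⟩ := (((((eventually_mem_Ioo_zero_one.and
    hsides).and (hin a haA)).and (hin _ haA')).and (hclosed a)).and
    (hclosed (lineMap z a (-1 : ℝ)))).exists
  -- A simplex containing a point close to `z` contains `z`, hence all of `ρ`; as the point is off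
  -- the hyperplane of `ρ`, the simplex spans `A`.
  have hex : ∀ a ∈ A, a ∉ affineSpan ℝ (ρ : Set (EuclideanSpace ℝ (Fin n))) →
      lineMap z a r ∈ T.space → (∀ s ∈ T.faces,
        lineMap z a r ∈ convexHull ℝ (s : Set (EuclideanSpace ℝ (Fin n))) →
        z ∈ convexHull ℝ (s : Set (EuclideanSpace ℝ (Fin n)))) →
      lineMap z a r ∉ affineSpan ℝ (ρ : Set (EuclideanSpace ℝ (Fin n))) ∧
      ∃ τ ∈ hT.spanning A, ρ ⊆ τ ∧
        lineMap z a r ∈ convexHull ℝ (τ : Set (EuclideanSpace ℝ (Fin n))) := by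
    intro a ha haρ hi hc
    have hout : lineMap z a r ∉ affineSpan ℝ (ρ : Set (EuclideanSpace ℝ (Fin n))) := fun h =>
      haρ (AffineSubspace.mem_of_lineMap_mem hr01.1.ne' hzspan h)
    obtain ⟨τ, hτ, hmem⟩ := Geometry.SimplicialComplex.mem_space_iff.1 hi
    have hzτ := hc τ hτ hmem
    have hρτ : ρ ⊆ τ := by
      have := T.inter_subset_convexHull hρT hτ ⟨hzρ, hzτ⟩
      rw [← Finset.coe_inter] at this
      exact (hsubρ _ Finset.inter_subset_left this).trans Finset.inter_subset_right
    refine ⟨hout, τ, IsTriangulation.mem_spanning_of_le hA hAd hτ ?_, hρτ, hmem⟩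
    have hB := hlt_eq (affineSpan ℝ (insert (lineMap z a r) (ρ : Set (EuclideanSpace ℝ (Fin n)))))
      (affineSpan_mono ℝ (Set.subset_insert _ _)) ?_
      (fun h => hout (h (subset_affineSpan ℝ _ (Set.mem_insert _ _))))
    · rw [← hB, affineSpan_le]
      refine Set.insert_subset (convexHull_subset_affineSpan _ hmem) ?_
      exact subset_trans (by exact_mod_cast hρτ) (subset_affineSpan ℝ _)
    · rw [affineSpan_le]
      exact Set.insert_subset (AffineMap.lineMap_mem _ (hρA hzspan) ha)
        ((subset_affineSpan ℝ _).trans hρA)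
  obtain ⟨hout, τ₁, hτ₁, hρτ₁, hm₁⟩ := hex a haA haspan hi hc
  obtain ⟨hout', τ₂, hτ₂, hρτ₂, hm₂⟩ := hex _ haA' haspan' hi' hc'
  -- The point `z` of the face `ρ` is the midpoint of the two side points, which are off `ρ`; faces
  -- being extreme, no single simplex with face `ρ` contains both.
  have hne : τ₁ ≠ τ₂ := by
    rintro rfl
    refine hout (convexHull_subset_affineSpan _
      ((isExtreme_convexHull_of_affineIndependent (T.indep (IsTriangulation.mem_spanning.1 hτ₁).1)
        hρτ₁).left_mem_of_mem_openSegment hm₁ hm₂ hzρ ⟨1 / 2, 1 / 2, by norm_num, by norm_num,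
        by norm_num, ?_⟩))
    simp only [lineMap_apply_module]
    module
  have hset : (hT.spanning A).filter (fun τ => ρ ⊆ τ) = {τ₁, τ₂} := by
    ext τ
    simp only [Finset.mem_insert, Finset.mem_singleton]
    constructor
    · intro hτ
      have hτ' := Finset.mem_filter.1 hτ
      rcases hs τ hτ with h | h
      · exact Or.inl (IsTriangulation.eq_of_facet_subset hAd hρ hτ'.1 hτ₁ hτ'.2 hρτ₁
          (fun h => hout (convexHull_subset_affineSpan _ h)) h hm₁)
      · exact Or.inr (IsTriangulation.eq_of_facet_subset hAd hρ hτ'.1 hτ₂ hτ'.2 hρτ₂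
          (fun h => hout' (convexHull_subset_affineSpan _ h)) h hm₂)
    · rintro (rfl | rfl)
      · exact Finset.mem_filter.2 ⟨hτ₁, hρτ₁⟩
      · exact Finset.mem_filter.2 ⟨hτ₂, hρτ₂⟩
  rw [hset, Finset.card_pair hne]
  exact even_two

end Complex

/-! ### Invariance of the parity while vertices move. -/

section Parity

variable {n d : ℕ} {P : Polytope n d} {T : Geometry.SimplicialComplex ℝ (EuclideanSpace ℝ (Fin n))}
  {hT : IsTriangulation P T} {A : AffineSubspace ℝ (EuclideanSpace ℝ (Fin n))}
  {κ : Type*} {label : EuclideanSpace ℝ (Fin n) → κ} {dest : κ → EuclideanSpace ℝ (Fin n)}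
  {y : EuclideanSpace ℝ (Fin n)}

open Classical in
/-- The vertices in `W` are moved to their destinations, the others stay. -/
noncomputable def moveVertices (label : EuclideanSpace ℝ (Fin n) → κ)
    (dest : κ → EuclideanSpace ℝ (Fin n)) (W : Finset (EuclideanSpace ℝ (Fin n)))
    (v : EuclideanSpace ℝ (Fin n)) : EuclideanSpace ℝ (Fin n) :=
  if v ∈ W then dest (label v) else v

open Classical in
/-- The indicator function of the convex hull of `s`, modulo `2`. -/
noncomputable def hullIndicator (s : Set (EuclideanSpace ℝ (Fin n)))
    (y : EuclideanSpace ℝ (Fin n)) : ZMod 2 :=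
  if y ∈ convexHull ℝ s then 1 else 0

/-- Some cell containing `u` has a span containing `A`; cells have dimension at most `d`, so this
span is `A`. -/
theorem IsDestination.mem_of_mem_spanning (hdest : IsDestination P T label dest)
    (hAd : Module.finrank ℝ A.direction = d) {σ : Finset (EuclideanSpace ℝ (Fin n))}
    (hσ : σ ∈ hT.spanning A) {u : EuclideanSpace ℝ (Fin n)} (hu : u ∈ σ) :
    dest (label u) ∈ A := by
  obtain ⟨hσT, hσA⟩ := IsTriangulation.mem_spanning.1 hσ
  have hA := AffineSubspace.nonempty_of_affineSpan_eq (T.nonempty_of_mem_faces hσT) hσA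
  obtain ⟨D, hD, huD, hle⟩ := hT.exists_cell hσT (subset_convexHull ℝ _ hu)
  have := (hdest u (T.coe_subset_vertices hσT hu)).2.2 D hD huD
  rwa [P.affineSpan_eq_of_le hA hAd hD (hσA ▸ hle)] at this

theorem IsDestination.moveVertices_mem (hdest : IsDestination P T label dest)
    (W : Finset (EuclideanSpace ℝ (Fin n))) {u : EuclideanSpace ℝ (Fin n)} (hu : u ∈ T.vertices) :
    moveVertices label dest W u ∈ T.vertices ∪ P.vertices := by
  unfold moveVertices
  split_ifs
  exacts [Or.inr (hdest u hu).1, Or.inl hu]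

theorem IsDestination.moveVertices_mem_spanning (hdest : IsDestination P T label dest)
    (hAd : Module.finrank ℝ A.direction = d) {σ : Finset (EuclideanSpace ℝ (Fin n))}
    (hσ : σ ∈ hT.spanning A) {u : EuclideanSpace ℝ (Fin n)} (hu : u ∈ σ)
    (W : Finset (EuclideanSpace ℝ (Fin n))) : moveVertices label dest W u ∈ A := by
  unfold moveVertices
  split_ifs
  · exact hdest.mem_of_mem_spanning hAd hσ hu
  · rw [← (IsTriangulation.mem_spanning.1 hσ).2]; exact subset_affineSpan ℝ _ hu

theorem exists_affine_dependence {ι E : Type*} [NormedAddCommGroup E] [NormedSpace ℝ E]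
    [FiniteDimensional ℝ E] {A : AffineSubspace ℝ E} {d : ℕ} (hAd : Module.finrank ℝ A.direction = d)
    {I : Finset ι} {q : ι → E} (hq : ∀ i ∈ I, q i ∈ A) (hI : I.card = d + 2) :
    ∃ k : ι → ℝ, ∑ j ∈ I, k j = 0 ∧ ∑ j ∈ I, k j • q j = 0 ∧ ∃ j ∈ I, k j ≠ 0 := by
  classical
  have hdep : ¬ AffineIndependent ℝ (fun i : I => q i) := by
    rw [← finrank_vectorSpan_le_iff_not_affineIndependent ℝ _ (n := d) (by simpa using hI), ← hAd,
      ← direction_affineSpan]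
    refine Submodule.finrank_mono (AffineSubspace.direction_le (affineSpan_le.2 ?_))
    rintro _ ⟨i, rfl⟩
    exact hq i i.2
  rw [_root_.affineIndependent_iff] at hdep
  push Not at hdep
  obtain ⟨s, w, hw, hwq, i, hi, hi0⟩ := hdep
  have hinter : I.attach ∩ s = s := Finset.inter_eq_right.2 fun i _ => I.mem_attach i
  let k : I → ℝ := fun i => if i ∈ s then w i else 0
  refine ⟨fun i => if h : i ∈ I then k ⟨i, h⟩ else 0, ?_, ?_, i, i.2, by simpa [k, hi] using hi0⟩
  · rw [← Finset.sum_coe_sort I]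
    simpa [k, hinter] using hw
  · rw [← Finset.sum_coe_sort I]
    simpa [k, hinter] using hwq

/-- Moving one vertex of a simplex changes the indicator function of its image by the indicator
functions of the simplices spanned by the old facets at this vertex and by its destination. -/
theorem IsDestination.hullIndicator_add_hullIndicator
    [DecidableEq (EuclideanSpace ℝ (Fin n))] (hdest : IsDestination P T label dest)
    (hAd : Module.finrank ℝ A.direction = d) (hy : IsGenericIn (T.vertices ∪ P.vertices) A y)
    {σ : Finset (EuclideanSpace ℝ (Fin n))} (hσ : σ ∈ hT.spanning A)
    (W : Finset (EuclideanSpace ℝ (Fin n))) {v : EuclideanSpace ℝ (Fin n)} (hv : v ∈ σ) :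
    hullIndicator (moveVertices label dest (insert v W) '' σ) y =
      hullIndicator (moveVertices label dest W '' σ) y +
      ∑ u ∈ σ.erase v, hullIndicator
        (insert (dest (label v)) (moveVertices label dest W '' (σ.erase u : Finset _))) y := by
  classical
  obtain ⟨hσT, hσA⟩ := IsTriangulation.mem_spanning.1 hσ
  have hA := AffineSubspace.nonempty_of_affineSpan_eq (T.nonempty_of_mem_faces hσT) hσA
  set φ := moveVertices label dest W
  -- The `d + 2` points: `none` is the destination of `v`, `some u` the current position of `u`.
  -- Omitting `none` gives the old image, omitting `some v` the new one.
  let q : Option (EuclideanSpace ℝ (Fin n)) → EuclideanSpace ℝ (Fin n) :=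
    fun i => i.elim (dest (label v)) φ
  let I := Finset.insertNone σ
  have hqA : ∀ i ∈ I, q i ∈ A := by
    rintro (_ | u) hi
    · exact hdest.mem_of_mem_spanning hAd hσ hv
    · exact hdest.moveVertices_mem_spanning hAd hσ (by simpa [I] using hi) W
  have hqX : ∀ i ∈ I, q i ∈ T.vertices ∪ P.vertices := by
    rintro (_ | u) hi
    · exact Or.inr (hdest v (T.coe_subset_vertices hσT hv)).1
    · exact hdest.moveVertices_mem W (T.coe_subset_vertices hσT (by simpa [I] using hi))
  have hI : I.card = d + 2 := by
    rw [Finset.card_insertNone, IsTriangulation.card_of_mem_spanning hAd hσ]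
  have heven := even_card_mem_convexHull_erase (y := y) (exists_affine_dependence hAd hqA hI) (by
    intro i hi j hj hij hmem
    have hsub : (I.erase i).erase j ⊆ I := (Finset.erase_subset _ _).trans (Finset.erase_subset _ _)
    rw [← Finset.coe_image] at hmem
    have h1 := finrank_direction_lt_card hA (hy _ (by
      rw [Finset.coe_image]
      rintro _ ⟨l, hl, rfl⟩
      exact hqX l (hsub hl)) (convexHull_subset_affineSpan _ hmem))
    have h2 := Finset.card_image_le (s := (I.erase i).erase j) (f := q)
    rw [Finset.card_erase_of_mem (by simp [hj, Ne.symm hij]), Finset.card_erase_of_mem hi] at h2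
    omega)
  have hsum : ∑ j ∈ I, hullIndicator (q '' (I.erase j : Finset _)) y = 0 := by
    rw [← (ZMod.natCast_eq_zero_iff_even).2 heven, Finset.card_filter]
    push_cast
    rfl
  have hnone : q '' (I.erase none : Finset _) = φ '' σ := by
    ext x
    simp only [Set.mem_image, Finset.mem_coe, Finset.mem_erase]
    constructor
    · rintro ⟨_ | u, ⟨h1, h2⟩, rfl⟩
      · exact absurd rfl h1
      · exact ⟨u, by simpa [I] using h2, rfl⟩
    · rintro ⟨u, hu, rfl⟩
      exact ⟨some u, ⟨by simp, by simpa [I] using hu⟩, rfl⟩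
  have hsome : ∀ u, q '' (I.erase (some u) : Finset _) =
      insert (dest (label v)) (φ '' (σ.erase u : Finset _)) := by
    intro u
    ext x
    simp only [Set.mem_image, Finset.mem_coe, Finset.mem_erase, Set.mem_insert_iff]
    constructor
    · rintro ⟨_ | l, ⟨h1, h2⟩, rfl⟩
      · exact Or.inl rfl
      · exact Or.inr ⟨l, ⟨by simpa using h1, by simpa [I] using h2⟩, rfl⟩
    · rintro (rfl | ⟨l, ⟨h1, h2⟩, rfl⟩)
      · exact ⟨none, ⟨by simp, by simp [I]⟩, rfl⟩
      · exact ⟨some l, ⟨by simpa using h1, by simpa [I] using h2⟩, rfl⟩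
  have hvv : insert (dest (label v)) (φ '' (σ.erase v : Finset _)) =
      moveVertices label dest (insert v W) '' σ := by
    conv_rhs => rw [← Finset.insert_erase hv, Finset.coe_insert, Set.image_insert_eq]
    congr 1
    · simp [moveVertices]
    · refine Set.image_congr fun u hu => ?_
      have : u ≠ v := Finset.ne_of_mem_erase hu
      simp [φ, moveVertices, this]
  rw [Finset.sum_insertNone, hnone, ← Finset.add_sum_erase _ _ hv] at hsum
  simp only [hsome, hvv] at hsum
  -- Signs do not matter modulo 2.
  have h2 : ∀ a b c : ZMod 2, a + (b + c) = 0 → b = a + c := by decide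
  exact h2 _ _ _ hsum

/-- All the points involved stay in the span of `ρ`, whose `d` vertices are too few for it to
contain a generic point of `A`. -/
theorem hullIndicator_facet_eq_zero
    (hAd : Module.finrank ℝ A.direction = d) (hy : IsGenericIn (T.vertices ∪ P.vertices) A y)
    (hA : (A : Set (EuclideanSpace ℝ (Fin n))).Nonempty)
    {ρ : Finset (EuclideanSpace ℝ (Fin n))} (hρT : ρ ∈ T.faces) (hρ : ρ.card = d)
    (hstay : ∀ u ∈ ρ, dest (label u) ∈ affineSpan ℝ (ρ : Set (EuclideanSpace ℝ (Fin n))))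
    (W : Finset (EuclideanSpace ℝ (Fin n))) {v : EuclideanSpace ℝ (Fin n)} (hv : v ∈ ρ) :
    hullIndicator (insert (dest (label v)) (moveVertices label dest W '' ρ)) y = 0 := by
  classical
  unfold hullIndicator
  rw [if_neg]
  intro hmem
  have hsub : insert (dest (label v)) (moveVertices label dest W '' ρ) ⊆
      (affineSpan ℝ (ρ : Set (EuclideanSpace ℝ (Fin n))) : Set (EuclideanSpace ℝ (Fin n))) := by
    refine Set.insert_subset (hstay v hv) ?_
    rintro _ ⟨u, hu, rfl⟩
    unfold moveVertices
    split_ifs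
    exacts [hstay u hu, subset_affineSpan ℝ _ hu]
  have hmem' := affineSpan_le.2 hsub (convexHull_subset_affineSpan _ hmem)
  have := finrank_direction_lt_card hA
    (hy ρ ((T.coe_subset_vertices hρT).trans Set.subset_union_left) hmem')
  omega

theorem IsDestination.sum_hullIndicator_insert (hdest : IsDestination P T label dest)
    (hAd : Module.finrank ℝ A.direction = d) (hy : IsGenericIn (T.vertices ∪ P.vertices) A y)
    (W : Finset (EuclideanSpace ℝ (Fin n))) (v : EuclideanSpace ℝ (Fin n))
    [DecidableEq (EuclideanSpace ℝ (Fin n))] :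
    ∑ σ ∈ hT.spanning A, hullIndicator (moveVertices label dest (insert v W) '' σ) y =
      ∑ σ ∈ hT.spanning A, hullIndicator (moveVertices label dest W '' σ) y := by
  let R := ((hT.spanning A).biUnion fun σ => σ.powersetCard d).filter fun ρ => v ∈ ρ
  let g : Finset (EuclideanSpace ℝ (Fin n)) → ZMod 2 := fun ρ =>
    hullIndicator (insert (dest (label v)) (moveVertices label dest W '' ρ)) y
  have hstep : ∀ σ ∈ hT.spanning A,
      hullIndicator (moveVertices label dest (insert v W) '' σ) y =
        hullIndicator (moveVertices label dest W '' σ) y + ∑ ρ ∈ R with ρ ⊆ σ, g ρ := by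
    intro σ hσ
    have hcard := IsTriangulation.card_of_mem_spanning hAd hσ
    by_cases hv : v ∈ σ
    · rw [hdest.hullIndicator_add_hullIndicator hAd hy hσ W hv]
      congr 1
      refine Finset.sum_bij (fun u _ => σ.erase u) ?_ ?_ ?_ ?_
      · intro u hu
        simp only [R, Finset.mem_filter, Finset.mem_biUnion, Finset.mem_powersetCard]
        exact ⟨⟨⟨σ, hσ, Finset.erase_subset _ _, by
          rw [Finset.card_erase_of_mem (Finset.mem_of_mem_erase hu), hcard]; rfl⟩,
          Finset.mem_erase.2 ⟨(Finset.ne_of_mem_erase hu).symm, hv⟩⟩, Finset.erase_subset _ _⟩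
      · intro u hu u' hu' h
        exact Finset.erase_injOn σ (Finset.mem_of_mem_erase hu) (Finset.mem_of_mem_erase hu') h
      · intro ρ hρ
        simp only [R, Finset.mem_filter, Finset.mem_biUnion, Finset.mem_powersetCard] at hρ
        obtain ⟨⟨⟨σ', -, -, hρd⟩, hvρ⟩, hρσ⟩ := hρ
        obtain ⟨u, hu, rfl⟩ := Finset.exists_eq_insert_iff.2 ⟨hρσ, by rw [hρd, hcard]⟩
        exact ⟨u, by simp only [Finset.mem_erase, Finset.mem_insert_self, and_true]
                     rintro rfl; exact hu hvρ, Finset.erase_insert hu⟩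
      · intro u hu
        rfl
    · rw [Finset.sum_eq_zero, add_zero]
      · congr 1
        refine Set.image_congr fun u hu => ?_
        have : u ≠ v := by rintro rfl; exact hv hu
        simp [moveVertices, this]
      · intro ρ hρ
        simp only [R, Finset.mem_filter] at hρ
        exact absurd (hρ.2 hρ.1.2) hv
  rw [Finset.sum_congr rfl hstep, Finset.sum_add_distrib, add_eq_left]
  -- The term `g ρ` does not depend on `σ`, so after exchanging the sums it is multiplied by the
  -- number of spanning simplices containing `ρ`.
  rw [Finset.sum_comm' (t' := R) (s' := fun ρ => (hT.spanning A).filter fun σ => ρ ⊆ σ)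
    (by intro σ ρ; simp only [Finset.mem_filter]; tauto)]
  refine Finset.sum_eq_zero fun ρ hρ => ?_
  simp only [R, Finset.mem_filter, Finset.mem_biUnion, Finset.mem_powersetCard] at hρ
  obtain ⟨⟨σ, hσ, hρσ, hρd⟩, hvρ⟩ := hρ
  obtain ⟨hσT, hσA⟩ := IsTriangulation.mem_spanning.1 hσ
  rw [Finset.sum_const, nsmul_eq_mul]
  by_cases hstay : ∀ u ∈ ρ, dest (label u) ∈ affineSpan ℝ (ρ : Set (EuclideanSpace ℝ (Fin n)))
  · have hA := AffineSubspace.nonempty_of_affineSpan_eq (T.nonempty_of_mem_faces hσT) hσA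
    have : g ρ = 0 := hullIndicator_facet_eq_zero hAd hy hA
      (T.down_closed hσT hρσ ⟨v, hvρ⟩) hρd hstay W hvρ
    rw [this, mul_zero]
  -- A cell that contains `u` and has its span inside that of `ρ` would hold the destination of `u`
  -- there. So no such cell exists, and the multiplicity is even.
  · push Not at hstay
    obtain ⟨u, hu, hout⟩ := hstay
    have := IsTriangulation.even_card_spanning_facet hAd hσ hρσ hρd hu fun F hF huF hle =>
      hout (hle ((hdest u (T.coe_subset_vertices hσT (hρσ hu))).2.2 F hF huF))
    rw [(ZMod.natCast_eq_zero_iff_even).2 this, zero_mul]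

/-- In general position, the parity of the number of spanning simplices whose image contains a
given point does not depend on which vertices have been moved. -/
theorem IsDestination.sum_hullIndicator_eq (hdest : IsDestination P T label dest)
    (hAd : Module.finrank ℝ A.direction = d) (hy : IsGenericIn (T.vertices ∪ P.vertices) A y) :
    ∑ σ ∈ hT.spanning A, hullIndicator ((fun v => dest (label v)) '' σ) y =
      ∑ σ ∈ hT.spanning A, hullIndicator (σ : Set (EuclideanSpace ℝ (Fin n))) y := by
  classical
  have h : ∀ W : Finset (EuclideanSpace ℝ (Fin n)),
      ∑ σ ∈ hT.spanning A, hullIndicator (moveVertices label dest W '' σ) y =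
      ∑ σ ∈ hT.spanning A, hullIndicator (moveVertices label dest ∅ '' σ) y := by
    intro W
    induction W using Finset.induction_on with
    | empty => rfl
    | insert v W _ ih => rw [hdest.sum_hullIndicator_insert hAd hy W v, ih]
  -- With this `W` every vertex of a spanning simplex has been moved; with `∅` none has.
  have h1 := h ((hT.spanning A).biUnion id)
  rw [Finset.sum_congr rfl fun σ hσ => ?_] at h1
  · rw [h1]
    refine Finset.sum_congr rfl fun σ _ => ?_
    congr 1
    ext u
    simp [moveVertices]
  · congr 1
    refine Set.image_congr fun u hu => ?_
    have : u ∈ (hT.spanning A).biUnion id := Finset.mem_biUnion.2 ⟨σ, hσ, hu⟩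
    simp only [moveVertices, this, if_true]

end Parity

/-! ### Barycentric coordinates and the end `H₁` of the homotopy. -/

section Barycentric

variable {n : ℕ} {T : Geometry.SimplicialComplex ℝ (EuclideanSpace ℝ (Fin n))}

/-- The point lies in the common face of `s` and the simplex carrying `w`, and coordinates in the
latter are unique. So the coordinates picked by choice in `barycentric` can be computed in any
simplex containing `x`. -/
theorem IsBarycentric.support_subset {x : EuclideanSpace ℝ (Fin n)}
    {w : EuclideanSpace ℝ (Fin n) →₀ ℝ} (hw : IsBarycentric T x w)
    {s : Finset (EuclideanSpace ℝ (Fin n))} (hs : s ∈ T.faces)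
    (hx : x ∈ convexHull ℝ (s : Set (EuclideanSpace ℝ (Fin n)))) : w.support ⊆ s := by
  classical
  have hxw : x ∈ convexHull ℝ (w.support : Set (EuclideanSpace ℝ (Fin n))) :=
    Finset.mem_convexHull'.2 ⟨w, fun v _ => hw.nonneg v, hw.sum_eq_one, hw.sum_smul_eq⟩
  have h := T.inter_subset_convexHull hw.support_mem hs ⟨hxw, hx⟩
  rw [← Finset.coe_inter] at h
  obtain ⟨u, -, hu0, hu1, hux⟩ :=
    Finset.exists_weights_of_mem_convexHull_subset (Finset.inter_subset_left (s₂ := s)) h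
  have key := Finset.eq_of_sum_smul_eq (T.indep hw.support_mem) (c := w) (c' := u)
    (hw.sum_eq_one.trans hu1.symm) (hw.sum_smul_eq.trans hux.symm)
  intro v hv
  by_contra hvs
  have := key v hv
  rw [hu0 v (by simp [hvs])] at this
  exact Finsupp.mem_support_iff.1 hv this

theorem labelHomotopy_one_apply {κ : Type*} (label : EuclideanSpace ℝ (Fin n) → κ)
    (dest : κ → EuclideanSpace ℝ (Fin n)) {s : Finset (EuclideanSpace ℝ (Fin n))}
    (hs : s ∈ T.faces) {w : EuclideanSpace ℝ (Fin n) → ℝ} (hw : ∀ v ∈ s, 0 ≤ w v)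
    (hw1 : ∑ v ∈ s, w v = 1) :
    labelHomotopy T label dest 1 (∑ v ∈ s, w v • v) = ∑ v ∈ s, w v • dest (label v) := by
  classical
  set x := ∑ v ∈ s, w v • v with hx
  let ω : EuclideanSpace ℝ (Fin n) →₀ ℝ :=
    Finsupp.onFinset s (fun v => if v ∈ s then w v else 0) (by intro v; simp; tauto)
  have hωs : ω.support ⊆ s := Finsupp.support_onFinset_subset
  have hωv : ∀ v ∈ s, ω v = w v := fun v hv => by simp [ω, hv]
  have hex : ∃ w, IsBarycentric T x w := by
    have h1 : (ω.sum fun _ a => a) = 1 := by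
      rw [Finsupp.sum_of_support_subset _ hωs _ (by simp), ← hw1]
      exact Finset.sum_congr rfl hωv
    refine ⟨ω, T.down_closed hs hωs ?_, ?_, h1, ?_⟩
    · by_contra h
      rw [Finset.not_nonempty_iff_eq_empty, Finsupp.support_eq_empty] at h
      simp [h] at h1
    · intro v
      simp only [ω, Finsupp.onFinset_apply]
      split_ifs with h
      exacts [hw v h, le_rfl]
    · rw [Finsupp.sum_of_support_subset _ hωs _ (by simp), hx]
      exact Finset.sum_congr rfl fun v hv => by rw [hωv v hv]
  have hb : IsBarycentric T x (barycentric T x) := by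
    rw [barycentric, dif_pos hex]
    exact hex.choose_spec
  have hsub := hb.support_subset hs (Finset.mem_convexHull'.2 ⟨w, hw, hw1, rfl⟩)
  have key := Finset.eq_of_sum_smul_eq (T.indep hs) (c := barycentric T x) (c' := w)
    (by rw [hw1, ← hb.sum_eq_one, Finsupp.sum_of_support_subset _ hsub _ (by simp)])
    (by rw [← hx]
        refine Eq.trans ?_ hb.sum_smul_eq
        rw [Finsupp.sum_of_support_subset _ hsub _ (by simp)])
  rw [labelHomotopy, Finsupp.sum_of_support_subset _ hsub _ (by simp)]
  exact Finset.sum_congr rfl fun v hv => by rw [key v hv]; simp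

/-- In particular, `H₁(s)` depends only on the set of colours of `s`. -/
theorem labelHomotopy_one_image {κ : Type*} (label : EuclideanSpace ℝ (Fin n) → κ)
    (dest : κ → EuclideanSpace ℝ (Fin n)) {s : Finset (EuclideanSpace ℝ (Fin n))}
    (hs : s ∈ T.faces) :
    labelHomotopy T label dest 1 '' convexHull ℝ (s : Set (EuclideanSpace ℝ (Fin n))) =
      convexHull ℝ ((fun v => dest (label v)) '' s) := by
  classical
  ext y
  rw [mem_convexHull_image_iff_exists]
  constructor
  · rintro ⟨x, hx, rfl⟩
    obtain ⟨w, hw, hw1, rfl⟩ := Finset.mem_convexHull'.1 hx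
    exact ⟨w, hw, hw1, (labelHomotopy_one_apply label dest hs hw hw1).symm⟩
  · rintro ⟨w, hw, hw1, rfl⟩
    exact ⟨_, Finset.mem_convexHull'.2 ⟨w, hw, hw1, rfl⟩,
      labelHomotopy_one_apply label dest hs hw hw1⟩

end Barycentric

/-! ### The jump of the parity at a boundary point. -/

section Main

variable {n d : ℕ} {P : Polytope n d} {T : Geometry.SimplicialComplex ℝ (EuclideanSpace ℝ (Fin n))}
  {hT : IsTriangulation P T} {A : AffineSubspace ℝ (EuclideanSpace ℝ (Fin n))}
  {C : Finset (EuclideanSpace ℝ (Fin n))} {x y : EuclideanSpace ℝ (Fin n)}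

/-- The `d`-cell whose relative boundary contains the boundary point `x` is the only cell spanning
its affine span and containing `x`. -/
theorem Polytope.eq_of_mem_of_unique (hC : C ∈ P.cells)
    (hAd : Module.finrank ℝ A.direction = d)
    (hCA : affineSpan ℝ (C : Set (EuclideanSpace ℝ (Fin n))) = A)
    (hxC : x ∈ intrinsicFrontier ℝ (convexHull ℝ (C : Set (EuclideanSpace ℝ (Fin n)))))
    (huniq : ∀ D ∈ P.cells,
      Module.finrank ℝ (vectorSpan ℝ (D : Set (EuclideanSpace ℝ (Fin n)))) = d →
      x ∈ intrinsicFrontier ℝ (convexHull ℝ (D : Set (EuclideanSpace ℝ (Fin n)))) → D = C)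
    {D : Finset (EuclideanSpace ℝ (Fin n))} (hD : D ∈ P.cells)
    (hDA : affineSpan ℝ (D : Set (EuclideanSpace ℝ (Fin n))) = A)
    (hxD : x ∈ convexHull ℝ (D : Set (EuclideanSpace ℝ (Fin n)))) : D = C := by
  by_cases hfr : x ∈ intrinsicFrontier ℝ (convexHull ℝ (D : Set (EuclideanSpace ℝ (Fin n))))
  · exact huniq D hD (by rw [← direction_affineSpan, hDA, hAd]) hfr
  exfalso
  have hxC' := intrinsicFrontier_subset C.isClosed_convexHull_coe hxC
  have hnhds := eventually_mem_of_notMem_intrinsicFrontier hxD hfr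
  rw [affineSpan_convexHull, hDA] at hnhds
  -- As `x` is relatively interior to `D`, every segment from `c` to `x` extends within `D` to `c' =
  -- x + r (x - c)`. Since `x` is in the common face of `C` and `D`, extremality then puts each cell
  -- inside the other, and `x` would be on the relative boundary of `D` after all.
  have hopp : ∀ c ∈ A, ∃ c' ∈ convexHull ℝ (D : Set (EuclideanSpace ℝ (Fin n))),
      x ∈ openSegment ℝ c c' := by
    intro c hc
    have hxA : x ∈ A := hDA ▸ convexHull_subset_affineSpan _ hxD
    have hcA := AffineMap.lineMap_mem (-1 : ℝ) hxA hc
    obtain ⟨r, hr, hr01⟩ := (((tendsto_lineMap_zero x (lineMap x c (-1 : ℝ))).eventually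
      hnhds).and eventually_mem_Ioo_zero_one).exists
    refine ⟨_, hr (AffineMap.lineMap_mem r hxA hcA), r / (1 + r), 1 / (1 + r), ?_, ?_, ?_, ?_⟩
    · have := hr01.1; positivity
    · have := hr01.1; positivity
    · have := hr01.1; field_simp; ring
    · have := hr01.1
      simp only [lineMap_apply_module]
      match_scalars <;> field_simp <;> ring
  have hxCD : x ∈ convexHull ℝ ((C : Set (EuclideanSpace ℝ (Fin n))) ∩ D) := by
    rw [← P.inter_eq C hC D hD]; exact ⟨hxC', hxD⟩
  have hDC : convexHull ℝ (D : Set (EuclideanSpace ℝ (Fin n))) ⊆ convexHull ℝ C := by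
    intro e he
    obtain ⟨e', he', hx⟩ := hopp e (hDA ▸ convexHull_subset_affineSpan _ he)
    have := (P.inter_face D hD C hC).isExtreme.left_mem_of_mem_openSegment he he'
      (by rwa [Set.inter_comm]) hx
    exact convexHull_mono Set.inter_subset_right this
  have hCD : convexHull ℝ (C : Set (EuclideanSpace ℝ (Fin n))) ⊆ convexHull ℝ D := by
    intro e he
    obtain ⟨e', he', hx⟩ := hopp e (hCA ▸ convexHull_subset_affineSpan _ he)
    have := (P.inter_face C hC D hD).isExtreme.left_mem_of_mem_openSegment he (hDC he') hxCD hx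
    exact convexHull_mono Set.inter_subset_right this
  exact hfr (hDC.antisymm hCD ▸ hxC)

theorem sum_hullIndicator_eq_one (hA : (A : Set (EuclideanSpace ℝ (Fin n))).Nonempty)
    (hAd : Module.finrank ℝ A.direction = d) {X : Set (EuclideanSpace ℝ (Fin n))}
    (hX : T.vertices ⊆ X) (hy : IsGenericIn X A y) (hyT : y ∈ T.space) :
    ∑ σ ∈ hT.spanning A, hullIndicator (σ : Set (EuclideanSpace ℝ (Fin n))) y = 1 := by
  obtain ⟨σ, hσT, hyσ⟩ := Geometry.SimplicialComplex.mem_space_iff.1 hyT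
  have hσ : σ ∈ hT.spanning A := IsTriangulation.mem_spanning_of_le hA hAd hσT
    (hy σ ((T.coe_subset_vertices hσT).trans hX) (convexHull_subset_affineSpan _ hyσ))
  rw [Finset.sum_eq_single_of_mem σ hσ]
  · exact if_pos hyσ
  · intro τ hτ hne
    exact if_neg fun hyτ => hne (IsTriangulation.eq_of_mem_of_isGenericIn hA hAd hX hy hτ hσ hyτ hyσ)

/-- Spanning `A` takes `d + 1` different destinations, and equal colours have equal destinations. -/
theorem injOn_of_le_affineSpan_image {κ : Type*} {label : EuclideanSpace ℝ (Fin n) → κ}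
    {dest : κ → EuclideanSpace ℝ (Fin n)}
    (hA : (A : Set (EuclideanSpace ℝ (Fin n))).Nonempty) (hAd : Module.finrank ℝ A.direction = d)
    {σ : Finset (EuclideanSpace ℝ (Fin n))} (hσ : σ ∈ hT.spanning A)
    (h : A ≤ affineSpan ℝ ((fun v => dest (label v)) '' (σ : Set (EuclideanSpace ℝ (Fin n))))) :
    Set.InjOn label (σ : Set (EuclideanSpace ℝ (Fin n))) := by
  classical
  rw [← Finset.coe_image] at h
  have h1 := finrank_direction_lt_card hA h
  have h2 := IsTriangulation.card_of_mem_spanning hAd hσ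
  have h3 := Finset.card_image_le (s := σ) (f := fun v => dest (label v))
  have h4 := Finset.card_image_iff.1 (show (σ.image fun v => dest (label v)).card = σ.card by omega)
  intro u hu v hv huv
  exact h4 hu hv (by simp only [huv])

/-- If no spanning image had `x` on its relative boundary, the parity of the images would be the
same at all generic points near `x`. But it is 1 inside `C` and 0 outside. -/
theorem IsDestination.false_of_notMem_intrinsicFrontier {κ : Type*}
    {label : EuclideanSpace ℝ (Fin n) → κ} {dest : κ → EuclideanSpace ℝ (Fin n)}
    (hdest : IsDestination P T label dest) (hC : C ∈ P.cells)
    (hAd : Module.finrank ℝ A.direction = d)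
    (hCA : affineSpan ℝ (C : Set (EuclideanSpace ℝ (Fin n))) = A)
    (hxC : x ∈ intrinsicFrontier ℝ (convexHull ℝ (C : Set (EuclideanSpace ℝ (Fin n)))))
    (huniq : ∀ D ∈ P.cells, affineSpan ℝ (D : Set (EuclideanSpace ℝ (Fin n))) = A →
      x ∈ convexHull ℝ (D : Set (EuclideanSpace ℝ (Fin n))) → D = C)
    (hfr : ∀ σ ∈ hT.spanning A,
      A ≤ affineSpan ℝ ((fun v => dest (label v)) '' (σ : Set (EuclideanSpace ℝ (Fin n)))) →
      x ∉ intrinsicFrontier ℝ (convexHull ℝ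
        ((fun v => dest (label v)) '' (σ : Set (EuclideanSpace ℝ (Fin n)))))) : False := by
  classical
  have hA := AffineSubspace.nonempty_of_affineSpan_eq (P.nonempty_of_mem C hC) hCA
  have hxC' := intrinsicFrontier_subset C.isClosed_convexHull_coe hxC
  have hX : (T.vertices ∪ P.vertices).Finite :=
    (T.finite_vertices hT.finite).union P.finite_vertices
  obtain ⟨b, hb, hgen⟩ := (convex_convexHull ℝ (C : Set (EuclideanSpace ℝ (Fin n)))).exists_isGenericIn
    ⟨x, hxC'⟩ hX
  rw [affineSpan_convexHull, hCA] at hgen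
  have hbA : b ∈ A := hCA ▸ convexHull_subset_affineSpan _ hb
  have hcells : ∀ᶠ y in 𝓝 x, ∀ D ∈ P.cells,
      y ∈ convexHull ℝ (D : Set (EuclideanSpace ℝ (Fin n))) →
      x ∈ convexHull ℝ (D : Set (EuclideanSpace ℝ (Fin n))) := by
    rw [eventually_all_finite P.finite_cells]
    intro D _
    by_cases h : x ∈ convexHull ℝ (D : Set (EuclideanSpace ℝ (Fin n)))
    · exact Eventually.of_forall fun _ _ => h
    · filter_upwards [D.isClosed_convexHull_coe.isOpen_compl.mem_nhds h] with y hy h'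
      exact absurd h' hy
  have himages : ∀ᶠ y in 𝓝 x, ∀ σ ∈ hT.spanning A,
      A ≤ affineSpan ℝ ((fun v => dest (label v)) '' (σ : Set (EuclideanSpace ℝ (Fin n)))) →
      y ∈ A → (y ∈ convexHull ℝ ((fun v => dest (label v)) '' (σ : Set (EuclideanSpace ℝ (Fin n)))) ↔
        x ∈ convexHull ℝ ((fun v => dest (label v)) '' (σ : Set (EuclideanSpace ℝ (Fin n))))) := by
    rw [eventually_all_finset]
    intro σ hσ
    by_cases hle : A ≤ affineSpan ℝ ((fun v => dest (label v)) '' (σ : Set (EuclideanSpace ℝ (Fin n))))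
    swap
    · exact Eventually.of_forall fun _ h => absurd h hle
    by_cases h : x ∈ convexHull ℝ
      ((fun v => dest (label v)) '' (σ : Set (EuclideanSpace ℝ (Fin n))))
    · have := eventually_mem_of_notMem_intrinsicFrontier h (hfr σ hσ hle)
      rw [affineSpan_convexHull] at this
      filter_upwards [this] with y hy _ hyA
      exact ⟨fun _ => h, fun _ => hy (hle hyA)⟩
    · have hclosed := ((σ.finite_toSet.image fun v => dest (label v))).isClosed_convexHull (𝕜 := ℝ)
      filter_upwards [hclosed.isOpen_compl.mem_nhds h] with y hy _ _
      exact ⟨fun h' => absurd h' hy, fun h' => absurd h' h⟩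
  -- a point inside `C`
  obtain ⟨r, ⟨hr1, hr2⟩, hr3⟩ := (((hgen.eventually_lineMap hX x).and
    ((tendsto_lineMap_zero x b).eventually himages)).and eventually_mem_Ioo_zero_one).exists
  have hmem := (convex_convexHull ℝ (C : Set (EuclideanSpace ℝ (Fin n)))).lineMap_mem hxC' hb
    ⟨hr3.1.le, hr3.2.le⟩
  have hone := sum_hullIndicator_eq_one (hT := hT) hA hAd Set.subset_union_left hr1
    (hT.space_eq ▸ Polytope.mem_space_iff.2 ⟨C, hC, hmem⟩)
  -- a point outside `C`
  obtain ⟨y, hyA, hyU, hyC⟩ := exists_notMem_of_mem_intrinsicFrontier hxC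
    (eventually_eventually_nhds.2 (hcells.and himages))
  rw [affineSpan_convexHull, hCA] at hyA
  -- The outside point `y` need not be generic, so it is moved slightly towards `b`. The closeness
  -- conditions hold on a neighbourhood of `y`, so they survive the move.
  obtain ⟨s, ⟨hs1, hs2⟩, hs3⟩ := (((hgen.eventually_lineMap hX y).and
    ((tendsto_lineMap_zero y b).eventually hyU)).and
    (eventually_lineMap_notMem_of_isClosed C.isClosed_convexHull_coe hyC b)).exists
  have hzero : ∑ σ ∈ hT.spanning A,
      hullIndicator (σ : Set (EuclideanSpace ℝ (Fin n))) (lineMap y b s) = 0 := by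
    -- A spanning simplex containing the outside point would put it into a cell `D` spanning `A`. By
    -- closeness `D` contains `x`, so `D = C`, which the point avoids.
    refine Finset.sum_eq_zero fun σ hσ => if_neg fun hmem => ?_
    obtain ⟨hσT, hσA⟩ := IsTriangulation.mem_spanning.1 hσ
    obtain ⟨D, hD, hyD, hle⟩ := hT.exists_cell hσT hmem
    have hDA := P.affineSpan_eq_of_le hA hAd hD (hσA ▸ hle)
    have := huniq D hD hDA (hs2.1 D hD hyD)
    exact hs3 (this ▸ hyD)
  rw [← hdest.sum_hullIndicator_eq hAd hr1] at hone
  rw [← hdest.sum_hullIndicator_eq hAd hs1, ← Finset.sum_congr rfl fun σ hσ => ?_, hone] at hzero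
  · exact one_ne_zero hzero
  -- Degenerate images contain no generic point, so only images spanning `A` count.
  have hle : ∀ y, IsGenericIn (T.vertices ∪ P.vertices) A y →
      y ∈ convexHull ℝ ((fun v => dest (label v)) '' (σ : Set (EuclideanSpace ℝ (Fin n)))) →
      A ≤ affineSpan ℝ ((fun v => dest (label v)) '' (σ : Set (EuclideanSpace ℝ (Fin n)))) := by
    intro y hy hmem
    have := hy (σ.image fun v => dest (label v)) ?_
      (by rw [Finset.coe_image]; exact convexHull_subset_affineSpan _ hmem)
    · rwa [Finset.coe_image] at this
    · rw [Finset.coe_image]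
      rintro _ ⟨u, hu, rfl⟩
      exact Or.inr (hdest u (T.coe_subset_vertices (IsTriangulation.mem_spanning.1 hσ).1 hu)).1
  have hxA : x ∈ A := hCA ▸ convexHull_subset_affineSpan _ hxC'
  unfold hullIndicator
  refine if_congr ⟨fun h => ?_, fun h => ?_⟩ rfl rfl
  · have hA' := hle _ hr1 h
    exact (hs2.2 σ hσ hA' (AffineMap.lineMap_mem _ hyA hbA)).2
      ((hr2 σ hσ hA' (AffineMap.lineMap_mem _ hxA hbA)).1 h)
  · have hA' := hle _ hs1 h
    exact (hr2 σ hσ hA' (AffineMap.lineMap_mem _ hxA hbA)).2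
      ((hs2.2 σ hσ hA' (AffineMap.lineMap_mem _ hyA hbA)).1 h)

end Main

theorem mainTheorem5 {n d : ℕ} {κ : Type*} (P : Polytope n d)
    (T : Geometry.SimplicialComplex ℝ (EuclideanSpace ℝ (Fin n))) (hT : IsTriangulation P T)
    (label : EuclideanSpace ℝ (Fin n) → κ) (hlabel : IsGeneralizedSperner P T label)
    (hboundary : Set.InjOn label (P.vertices ∩ P.boundary))
    (dest : κ → EuclideanSpace ℝ (Fin n)) (hdest : IsDestination P T label dest)
    (S : Set (Finset (EuclideanSpace ℝ (Fin n)))) (hS : S ⊆ T.faces)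
    (hcover : ¬ P.boundary ⊆ ⋃ s ∈ S, intrinsicFrontier ℝ
      (labelHomotopy T label dest 1 '' convexHull ℝ (s : Set (EuclideanSpace ℝ (Fin n))))) :
    ∃ τ, IsFullColoured d T label τ ∧
      ∀ s ∈ S, label '' (τ : Set (EuclideanSpace ℝ (Fin n))) ≠
        label '' (s : Set (EuclideanSpace ℝ (Fin n))) := by
  obtain ⟨x, ⟨C, ⟨hC, hCd, hxC⟩, huniq⟩, hxS⟩ := Set.not_subset.1 hcover
  simp only [Set.mem_iUnion, not_exists] at hxS
  by_contra! hcon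
  have hAd : Module.finrank ℝ
      (affineSpan ℝ (C : Set (EuclideanSpace ℝ (Fin n)))).direction = d := by
    rw [direction_affineSpan, hCd]
  have hA := AffineSubspace.nonempty_of_affineSpan_eq (P.nonempty_of_mem C hC) rfl
  refine hdest.false_of_notMem_intrinsicFrontier (hT := hT) hC hAd rfl hxC
    (fun D hD hDA hxD => P.eq_of_mem_of_unique hC hAd rfl hxC
      (fun D hD hDd hxD => huniq D ⟨hD, hDd, hxD⟩) hD hDA hxD) fun σ hσ hle => ?_
  obtain ⟨s, hs, hlab⟩ := hcon σ ⟨(IsTriangulation.mem_spanning.1 hσ).1,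
    IsTriangulation.card_of_mem_spanning hAd hσ, injOn_of_le_affineSpan_image hA hAd hσ hle⟩
  have h := hxS s hs
  rw [labelHomotopy_one_image label dest (hS hs)] at h
  -- Equal colour sets have equal sets of destinations, so the image of `σ` is `H₁(s)`.
  rw [show (fun v => dest (label v)) '' (σ : Set (EuclideanSpace ℝ (Fin n))) =
    (fun v => dest (label v)) '' (s : Set (EuclideanSpace ℝ (Fin n))) by
      rw [← Function.comp_def dest label, Set.image_comp, hlab, ← Set.image_comp]]
  exact h
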